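/- **Conventions.** All manifolds and metrics are $C^\infty$. An almost contact metric manifold $(N,\phi,\xi,\eta,g)$ is a $(2n+1)$-dimensional Riemannian manifold with a $(1,1)$-tensor field $\phi$, a vector field $\xi$ and a $1$-form $\eta$ such that $\phi^2=-I+\eta\otimes\xi$, $\eta(\xi)=1$ and $g(\phi X,\phi Y)=g(X,Y)-\eta(X)\eta(Y)$. Put $\Phi(X,Y)=g(X,\phi Y)$, $d\eta(X,Y)=\tfrac12\bigl(X\eta(Y)-Y\eta(X)-\eta([X,Y])\bigr)$ and let $N_\phi(X,Y)=\phi^2[X,Y]+[\phi X,\phi Y]-\phi[\phi X,Y]-\phi[X,\phi Y]$. The structure is normal if $N_\phi+2\,d\eta\otimes\xi=0$; $N$ is *Sasakian* if it is normal and $\Phi=d\eta$; *cosymplectic* if it is normal and $d\eta=0$, $d\Phi=0$; *Kenmotsu* if $(\overline\nabla_X\phi)Y=g(\phi X,Y)\xi-\eta(Y)\phi X$, with $\overline\nabla$ the Levi-Civita connection of $N$. Let $M=B\times_f\overline F$ be a warped product of Riemannian manifolds $B$ and $\overline F$ with warping function a positive $C^\infty$ function $f$ on $B$ (so $g_M=g_B+f^2g_{\overline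 F}$), isometrically immersed in $N$ as a submanifold with normal bundle $TM^\perp$ and second fundamental form $h$. Write $\|h\|^2=\sum_{i,j}g(h(e_i,e_j),h(e_i,e_j))$ for an orthonormal basis $(e_i)$ of the tangent space of $M$. Assume that $\xi$ is tangent to $M$ and that $M$ is *proper pointwise semi-slant* with $\mathcal D_1=TB$, $\mathcal D_2=T\overline F$ and semi-slant function $\theta$: that is, $\phi(TB)\subset TB$ and, at each $p\in M$, for all nonzero $X\in (T\overline F)_p$ one has $\phi X\neq0$ and the angle between $\phi X$ and the subspace $(T\overline F)_p$ is $\theta(p)$, where $\theta:M\to(0,\tfrac{\pi}{2})$. **Theorem.** Let $\dim B=2m_1+1$, $\dim\overline F=2m_2$, $\dim N=2n+1$ and assume that $n=m_1+2m_2$. 1. If $N$ is Sasakian, then at every point of $M$ $$\|h\|^2\ \ge\ 4m_2\,(\csc^2\theta+\cot^2\theta)\,\|\phi\nabla(\ln f)\|^2+4m_2\sin^2\theta .$$ 2. If $N$ is cosymplectic, then at every point of $M$ $$\|h\|^2\ \ge\ 4m_2\,(\csc^2\theta+\cot^2\theta)\,\|\phi\nabla(\ln f)\|^2 .$$ 3.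 If $N$ is Kenmotsu, then at every point of $M$ $$\|h\|^2\ \ge\ 4m_2\,(\csc^2\theta+\cot^2\theta)\,\|\phi\nabla(\ln f)\|^2 .$$ Here $\nabla(\ln f)$ is the gradient on $M$ of $\ln f$, regarded as a function on $M$. In each case equality holds at a point $p\in M$ if and only if $g(h(Z,W),V)=0$ for all $Z,W\in (T\overline F)_p$ and all normal vectors $V\in (T_pM)^\perp$. -/

import Mathlib

open Bundle Manifold VectorField
open scoped ContDiff InnerProductSpace

/-! Riemannian metrics are Mathlib's: `RiemannianBundle` provides the inner product on the tangent
spaces and `IsContMDiffRiemannianBundle` its smoothness. -/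

namespace SemiSlant

noncomputable section

section Manifolds

variable {E : Type*} [NormedAddCommGroup E] [NormedSpace ℝ E] [FiniteDimensional ℝ E]
  {H : Type*} [TopologicalSpace H] (I : ModelWithCorners ℝ E H)
  {N : Type*} [TopologicalSpace N] [ChartedSpace H N] [IsManifold I ∞ N]
  [RiemannianBundle (fun x : N => TangentSpace I x)]
  {E' : Type*} [NormedAddCommGroup E'] [NormedSpace ℝ E'] [FiniteDimensional ℝ E']
  {H' : Type*} [TopologicalSpace H'] (J : ModelWithCorners ℝ E' H')
  {M : Type*} [TopologicalSpace M] [ChartedSpace H' M] [IsManifold J ∞ M]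
  [RiemannianBundle (fun x : M => TangentSpace J x)]

instance instFiniteDimensionalTangentSpace (x : N) : FiniteDimensional ℝ (TangentSpace I x) :=
  inferInstanceAs (FiniteDimensional ℝ E)

/-! ### Levi-Civita connection, gradient -/

/-- The coordinate vector field with value `v` at `q`: near `q`, its components with respect to the
preferred chart at `q` are constant. -/
def coordField {q : N} (v : TangentSpace I q) (x : N) : TangentSpace I x :=
  (trivializationAt E (TangentSpace I) q).symmL ℝ x
    ((trivializationAt E (TangentSpace I) q).continuousLinearMapAt ℝ q v)

/-- The derivative `∂_w g(u, v)` at `q` of a coefficient of the metric in the chart at `q`. -/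
def metricDeriv {q : N} (w u v : TangentSpace I q) : ℝ :=
  mvfderiv I (fun x : N => ⟪coordField I u x, coordField I v x⟫_ℝ) q w

/-- The Christoffel symbol `Γ(u, v)` of the Levi-Civita connection in the chart at `q`, i.e. the
vector with `g(Γ(u, v), z) = (∂_u g(v, z) + ∂_v g(u, z) - ∂_z g(u, v)) / 2` for all `z`. -/
def christoffel {q : N} (u v : TangentSpace I q) : TangentSpace I q :=
  let b := stdOrthonormalBasis ℝ (TangentSpace I q)
  ∑ k, ((metricDeriv I u v (b k) + metricDeriv I v u (b k) - metricDeriv I (b k) u v) / 2) • b k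

/-- The Levi-Civita covariant derivative `∇_u V` on `N` of a vector field `V` along a map
`F : M → N`, computed in the chart of `N` at `F p` as `∂_u V + Γ(dF u, V)`. -/
def covDerivAlong (F : M → N) (V : Π x : M, TangentSpace I (F x)) (p : M)
    (u : TangentSpace J p) : TangentSpace I (F p) :=
  (trivializationAt E (TangentSpace I) (F p)).symmL ℝ (F p)
      (mvfderiv J (fun x : M =>
        (trivializationAt E (TangentSpace I) (F p)).continuousLinearMapAt ℝ (F x) (V x)) p u)
    + christoffel I (mfderiv J I F p u) (V p)

/-- The Levi-Civita covariant derivative `∇_u Y` of a vector field `Y` on `N` (the same formula, for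
the identity map of `N`). -/
def covDeriv (Y : Π x : N, TangentSpace I x) (p : N) (u : TangentSpace I p) : TangentSpace I p :=
  (trivializationAt E (TangentSpace I) p).symmL ℝ p
      (mvfderiv I (fun x : N =>
        (trivializationAt E (TangentSpace I) p).continuousLinearMapAt ℝ x (Y x)) p u)
    + christoffel I u (Y p)

/-- The gradient of a function. -/
def grad (F : M → ℝ) (p : M) : TangentSpace J p :=
  let b := stdOrthonormalBasis ℝ (TangentSpace J p)
  ∑ k, mvfderiv J F p (b k) • b k

/-- Smoothness of a (possibly only locally smooth) vector field at the point `p`. -/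
def SmoothFieldAt (Y : Π x : N, TangentSpace I x) (p : N) : Prop :=
  ContMDiffAt I I.tangent ∞ (fun x => (⟨x, Y x⟩ : TangentBundle I N)) p

/-! ### Submanifolds -/

/-- `i : M → N` is a smooth isometric immersion, i.e. it presents `M`, with its Riemannian metric,
as a Riemannian submanifold of `N`. -/
structure IsIsometricImmersion (i : M → N) : Prop where
  contMDiff : ContMDiff J I ∞ i
  inner_mfderiv : ∀ (p : M) (u v : TangentSpace J p),
    ⟪mfderiv J I i p u, mfderiv J I i p v⟫_ℝ = ⟪u, v⟫_ℝ

/-- The tangent space of the submanifold, as a subspace of the tangent space of `N`. -/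
def tangentRange (i : M → N) (p : M) : Submodule ℝ (TangentSpace I (i p)) :=
  LinearMap.range (mfderiv J I i p).toLinearMap

/-- The normal space of the submanifold. -/
def normalSpace (i : M → N) (p : M) : Submodule ℝ (TangentSpace I (i p)) :=
  (tangentRange I J i p)ᗮ

/-- The second fundamental form: `h(u, v)` is the normal component of the covariant derivative in
`N`, in the direction of `u`, of a vector field tangent to `M` with value `v` at `p`. -/
def secondFF (i : M → N) (p : M) (u v : TangentSpace J p) : TangentSpace I (i p) :=
  (normalSpace I J i p).starProjection
    (covDerivAlong I J i (fun x => mfderiv J I i x (coordField J v x)) p u)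

/-- The squared norm `‖h‖²`, the sum of the `g(h(e_j, e_k), h(e_j, e_k))` over an orthonormal
basis. -/
def sqNormSecondFF (i : M → N) (p : M) : ℝ :=
  let e := stdOrthonormalBasis ℝ (TangentSpace J p)
  ∑ j, ∑ k, ⟪secondFF I J i p (e j) (e k), secondFF I J i p (e j) (e k)⟫_ℝ

/-! ### Almost contact metric structures -/

variable (N) in
/-- An almost contact metric structure `(φ, ξ, η, g)`, where `g` is the metric of `N`. -/
structure AlmostContactMetric where
  φ : Π x : N, TangentSpace I x →L[ℝ] TangentSpace I x
  ξ : Π x : N, TangentSpace I x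
  η : Π x : N, TangentSpace I x →L[ℝ] ℝ
  contMDiff_φ : ContMDiff I (I.prod 𝓘(ℝ, E →L[ℝ] E)) ∞
    (fun x => TotalSpace.mk' (E →L[ℝ] E)
      (E := fun x : N => TangentSpace I x →L[ℝ] TangentSpace I x) x (φ x))
  contMDiff_ξ : ContMDiff I I.tangent ∞ (fun x => (⟨x, ξ x⟩ : TangentBundle I N))
  contMDiff_η : ContMDiff I (I.prod 𝓘(ℝ, E →L[ℝ] ℝ)) ∞
    (fun x => TotalSpace.mk' (E →L[ℝ] ℝ) (E := fun x : N => TangentSpace I x →L[ℝ] ℝ) x (η x))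
  φ_φ : ∀ (x : N) (v : TangentSpace I x), φ x (φ x v) = -v + η x v • ξ x
  η_ξ : ∀ x : N, η x (ξ x) = 1
  inner_φ_φ : ∀ (x : N) (u v : TangentSpace I x),
    ⟪φ x u, φ x v⟫_ℝ = ⟪u, v⟫_ℝ - η x u * η x v

namespace AlmostContactMetric

variable {I} (S : AlmostContactMetric I N)

/-- The vector field `φ Y`. -/
def φField (Y : Π x : N, TangentSpace I x) (x : N) : TangentSpace I x := S.φ x (Y x)

/-- The fundamental `2`-form `Φ(X, Y) = g(X, φ Y)`. -/
def fundForm (X Y : Π x : N, TangentSpace I x) (x : N) : ℝ := ⟪X x, S.φ x (Y x)⟫_ℝ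

/-- The exterior derivative of `η`, in the usual normalization of contact metric geometry,
`dη(X, Y) = (X(η(Y)) - Y(η(X)) - η([X, Y])) / 2`. -/
def dη (X Y : Π x : N, TangentSpace I x) (p : N) : ℝ :=
  (mvfderiv I (fun x => S.η x (Y x)) p (X p) - mvfderiv I (fun x => S.η x (X x)) p (Y p)
    - S.η p (mlieBracket I X Y p)) / 2

/-- The exterior derivative of the fundamental `2`-form,
`dΦ(X, Y, Z) = (X Φ(Y, Z) + Y Φ(Z, X) + Z Φ(X, Y)
  - Φ([X, Y], Z) - Φ([Y, Z], X) - Φ([Z, X], Y)) / 3`. -/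
def dΦ (X Y Z : Π x : N, TangentSpace I x) (p : N) : ℝ :=
  (mvfderiv I (S.fundForm Y Z) p (X p) + mvfderiv I (S.fundForm Z X) p (Y p)
    + mvfderiv I (S.fundForm X Y) p (Z p)
    - S.fundForm (mlieBracket I X Y) Z p - S.fundForm (mlieBracket I Y Z) X p
    - S.fundForm (mlieBracket I Z X) Y p) / 3

/-- The Nijenhuis tensor of `φ`. -/
def nijenhuis (X Y : Π x : N, TangentSpace I x) (p : N) : TangentSpace I p :=
  S.φ p (S.φ p (mlieBracket I X Y p)) + mlieBracket I (S.φField X) (S.φField Y) p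
    - S.φ p (mlieBracket I (S.φField X) Y p) - S.φ p (mlieBracket I X (S.φField Y) p)

/-- Contact metric structures: `Φ = dη`. -/
def IsContact : Prop :=
  ∀ (p : N) (X Y : Π x : N, TangentSpace I x), SmoothFieldAt I X p → SmoothFieldAt I Y p →
    S.fundForm X Y p = S.dη X Y p

/-- Normal structures: the Nijenhuis tensor of `φ` is `-2 dη ⊗ ξ`. -/
def IsNormal : Prop :=
  ∀ (p : N) (X Y : Π x : N, TangentSpace I x), SmoothFieldAt I X p → SmoothFieldAt I Y p →
    S.nijenhuis X Y p + (2 * S.dη X Y p) • S.ξ p = 0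

/-- Sasakian structures: contact and normal. -/
def IsSasakian : Prop := S.IsContact ∧ S.IsNormal

/-- Almost cosymplectic structures: `η` and `Φ` are closed. -/
def IsAlmostCosymplectic : Prop :=
  (∀ (p : N) (X Y : Π x : N, TangentSpace I x), SmoothFieldAt I X p → SmoothFieldAt I Y p →
    S.dη X Y p = 0) ∧
  ∀ (p : N) (X Y Z : Π x : N, TangentSpace I x), SmoothFieldAt I X p → SmoothFieldAt I Y p →
    SmoothFieldAt I Z p → S.dΦ X Y Z p = 0

/-- Cosymplectic structures: almost cosymplectic and normal. -/
def IsCosymplectic : Prop := S.IsAlmostCosymplectic ∧ S.IsNormal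

/-- Kenmotsu structures: `(∇_X φ) Y = g(φ X, Y) ξ - η(Y) φ X`, where
`(∇_X φ) Y = ∇_X (φ Y) - φ (∇_X Y)`. -/
def IsKenmotsu : Prop :=
  ∀ (p : N) (X Y : Π x : N, TangentSpace I x), SmoothFieldAt I X p → SmoothFieldAt I Y p →
    covDeriv I (S.φField Y) p (X p) - S.φ p (covDeriv I Y p (X p))
      = ⟪S.φ p (X p), Y p⟫_ℝ • S.ξ p - S.η p (Y p) • S.φ p (X p)

/-- The submanifold `M` of `N` is pointwise semi-slant with respect to the distributions `D₁`, `D₂`,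
with semi-slant function `θ`: `D₂` is the orthogonal complement of `D₁` in `TM`, `φ D₁ ⊆ D₁`, and
for every nonzero `v ∈ D₂` at `p` the angle between (the nonzero vector) `φ v` and the subspace
`D₂`, i.e. between `φ v` and its orthogonal projection to `D₂`, is `θ p`. (Smoothness of the
distribution `D₁` is not part of this predicate; the factors of a product are smooth.) -/
structure IsPointwiseSemiSlant (i : M → N) (D₁ D₂ : Π p : M, Submodule ℝ (TangentSpace J p))
    (θ : M → ℝ) : Prop where
  orthogonal : ∀ p, D₂ p = (D₁ p)ᗮ
  invariant : ∀ p, ∀ u ∈ D₁ p,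
    S.φ (i p) (mfderiv J I i p u) ∈ (D₁ p).map (mfderiv J I i p).toLinearMap
  slant : ∀ p, ∀ v ∈ D₂ p, v ≠ 0 →
    S.φ (i p) (mfderiv J I i p v) ≠ 0 ∧
    InnerProductGeometry.angle (S.φ (i p) (mfderiv J I i p v))
      (((D₂ p).map (mfderiv J I i p).toLinearMap).starProjection
        (S.φ (i p) (mfderiv J I i p v))) = θ p

end AlmostContactMetric

end Manifolds

/-! ### Warped products -/

section Warped

variable {EB : Type*} [NormedAddCommGroup EB] [NormedSpace ℝ EB]
  {HB : Type*} [TopologicalSpace HB] (IB : ModelWithCorners ℝ EB HB)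
  {B : Type*} [TopologicalSpace B] [ChartedSpace HB B]
  [RiemannianBundle (fun x : B => TangentSpace IB x)]
  {EF : Type*} [NormedAddCommGroup EF] [NormedSpace ℝ EF]
  {HF : Type*} [TopologicalSpace HF] (IF : ModelWithCorners ℝ EF HF)
  {F : Type*} [TopologicalSpace F] [ChartedSpace HF F]
  [RiemannianBundle (fun x : F => TangentSpace IF x)]

/-- The distribution `TB` on `B × F`: the vectors tangent to the slices `B × {y}`. -/
def baseDistribution (p : B × F) : Submodule ℝ (TangentSpace (IB.prod IF) p) :=
  LinearMap.ker (mfderiv (IB.prod IF) IF (Prod.snd : B × F → F) p).toLinearMap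

/-- The distribution `TF` on `B × F`: the vectors tangent to the slices `{x} × F`. -/
def fiberDistribution (p : B × F) : Submodule ℝ (TangentSpace (IB.prod IF) p) :=
  LinearMap.ker (mfderiv (IB.prod IF) IB (Prod.fst : B × F → B) p).toLinearMap

/-- The metric of `B × F` is the warped product metric `g_B + f² g_F`, with warping function the
positive smooth function `f` on `B`. -/
structure IsWarpedProduct [RiemannianBundle (fun p : B × F => TangentSpace (IB.prod IF) p)]
    (f : B → ℝ) : Prop where
  contMDiff : ContMDiff IB 𝓘(ℝ, ℝ) ∞ f
  pos : ∀ x, 0 < f x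
  inner_eq : ∀ (p : B × F) (u v : TangentSpace (IB.prod IF) p),
    ⟪u, v⟫_ℝ =
      ⟪mfderiv (IB.prod IF) IB (Prod.fst : B × F → B) p u,
        mfderiv (IB.prod IF) IB (Prod.fst : B × F → B) p v⟫_ℝ
      + f p.1 ^ 2 *
        ⟪mfderiv (IB.prod IF) IF (Prod.snd : B × F → F) p u,
          mfderiv (IB.prod IF) IF (Prod.snd : B × F → F) p v⟫_ℝ

end Warped

end

end SemiSlant

set_option linter.unusedSectionVars false

namespace SemiSlant

section Calculus

open Filter Topology

variable {E : Type*} [NormedAddCommGroup E] [NormedSpace ℝ E] [FiniteDimensional ℝ E]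
  {H : Type*} [TopologicalSpace H] {I : ModelWithCorners ℝ E H}
  {N : Type*} [TopologicalSpace N] [ChartedSpace H N] [IsManifold I ∞ N]
  [RiemannianBundle (fun x : N => TangentSpace I x)]
  {E' : Type*} [NormedAddCommGroup E'] [NormedSpace ℝ E'] [FiniteDimensional ℝ E']
  {H' : Type*} [TopologicalSpace H'] {J : ModelWithCorners ℝ E' H'}
  {M : Type*} [TopologicalSpace M] [ChartedSpace H' M] [IsManifold J ∞ M]

variable (I) in
/-- The coordinate expression, in the chart at `q`, of a tangent vector at `y`. -/
noncomputable abbrev toCoord (q y : N) : TangentSpace I y →L[ℝ] E :=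
  (trivializationAt E (TangentSpace I) q).continuousLinearMapAt ℝ y

variable (I) in
/-- The tangent vector at `y` with given coordinates in the chart at `q`. -/
noncomputable abbrev ofCoord (q y : N) : E →L[ℝ] TangentSpace I y :=
  (trivializationAt E (TangentSpace I) q).symmL ℝ y

variable (I J) in
/-- Differentiability at `p` of a vector field along a map. -/
def DiffFieldAt (F : M → N) (V : Π x : M, TangentSpace I (F x)) (p : M) : Prop :=
  MDifferentiableAt J I.tangent (fun x => (⟨F x, V x⟩ : TangentBundle I N)) p

theorem ofCoord_toCoord {q y : N} (hy : y ∈ (chartAt H q).source) (v : TangentSpace I y) :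
    ofCoord I q y (toCoord I q y v) = v :=
  (trivializationAt E (TangentSpace I) q).symmL_continuousLinearMapAt (by simpa using hy) v

theorem toCoord_ofCoord {q y : N} (hy : y ∈ (chartAt H q).source) (v : E) :
    toCoord I q y (ofCoord I q y v) = v :=
  (trivializationAt E (TangentSpace I) q).continuousLinearMapAt_symmL (by simpa using hy) v

theorem coordField_self {q : N} (v : TangentSpace I q) : coordField I v q = v :=
  ofCoord_toCoord (mem_chart_source H q) v

theorem toCoord_coordField {q y : N} (hy : y ∈ (chartAt H q).source) (v : TangentSpace I q) :
    toCoord I q y (coordField I v y) = toCoord I q q v :=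
  toCoord_ofCoord hy _

theorem coordField_add {q : N} (u v : TangentSpace I q) (x : N) :
    coordField I (u + v) x = coordField I u x + coordField I v x := by
  simp [coordField]

theorem coordField_smul {q : N} (c : ℝ) (v : TangentSpace I q) (x : N) :
    coordField I (c • v) x = c • coordField I v x := by
  simp [coordField]

theorem eventually_mem_chart {F : M → N} {p : M} (hF : ContinuousAt F p) :
    ∀ᶠ x in 𝓝 p, F x ∈ (chartAt H (F p)).source :=
  hF.preimage_mem_nhds (chart_source_mem_nhds H (F p))

theorem diffFieldAt_iff {F : M → N} {V : Π x : M, TangentSpace I (F x)} {p : M} :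
    DiffFieldAt I J F V p ↔ MDifferentiableAt J I F p ∧
      MDifferentiableAt J 𝓘(ℝ, E) (fun x => toCoord I (F p) (F x) (V x)) p := by
  unfold DiffFieldAt
  rw [mdifferentiableAt_totalSpace]
  refine and_congr_right fun hF => ?_
  refine Filter.EventuallyEq.mdifferentiableAt_iff ?_
  filter_upwards [eventually_mem_chart (H := H) hF.continuousAt] with x hx
  rw [toCoord, Trivialization.continuousLinearMapAt_apply,
    Trivialization.coe_linearMapAt_of_mem _ (by simpa using hx)]

theorem contMDiffAt_coordField {q : N} (v : TangentSpace I q) :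
    ContMDiffAt I I.tangent ∞ (fun x => (⟨x, coordField I v x⟩ : TangentBundle I N)) q := by
  rw [Bundle.contMDiffAt_section]
  refine (contMDiffAt_const (c := toCoord I q q v)).congr_of_eventuallyEq ?_
  filter_upwards [chart_source_mem_nhds H q] with x hx
  rw [← toCoord_coordField hx v, toCoord, Trivialization.continuousLinearMapAt_apply,
    Trivialization.coe_linearMapAt_of_mem _ (by simpa using hx)]

theorem smoothFieldAt_coordField {q : N} (v : TangentSpace I q) :
    SmoothFieldAt I (coordField I v) q :=
  contMDiffAt_coordField v

theorem SmoothFieldAt.diffFieldAt {Y : Π x : N, TangentSpace I x} {q : N}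
    (hY : SmoothFieldAt I Y q) : DiffFieldAt I I id Y q :=
  ContMDiffAt.mdifferentiableAt hY (by simp)

theorem DiffFieldAt.comp {Y : Π x : N, TangentSpace I x} {F : M → N} {p : M}
    (hY : DiffFieldAt I I id Y (F p)) (hF : MDifferentiableAt J I F p) :
    DiffFieldAt I J F (fun x => Y (F x)) p :=
  MDifferentiableAt.comp p (g := fun y => (⟨y, Y y⟩ : TangentBundle I N)) hY hF

theorem DiffFieldAt.mdifferentiableAt {F : M → N} {V : Π x : M, TangentSpace I (F x)} {p : M}
    (hV : DiffFieldAt I J F V p) : MDifferentiableAt J I F p :=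
  (diffFieldAt_iff.1 hV).1

theorem DiffFieldAt.add {F : M → N} {V W : Π x : M, TangentSpace I (F x)} {p : M}
    (hV : DiffFieldAt I J F V p) (hW : DiffFieldAt I J F W p) :
    DiffFieldAt I J F (fun x => V x + W x) p := by
  rw [diffFieldAt_iff] at *
  refine ⟨hV.1, ?_⟩
  simp only [map_add]
  exact hV.2.add hW.2

theorem DiffFieldAt.smul {F : M → N} {V : Π x : M, TangentSpace I (F x)} {a : M → ℝ} {p : M}
    (ha : MDifferentiableAt J 𝓘(ℝ, ℝ) a p) (hV : DiffFieldAt I J F V p) :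
    DiffFieldAt I J F (fun x => a x • V x) p := by
  rw [diffFieldAt_iff] at *
  refine ⟨hV.1, ?_⟩
  simp only [map_smul]
  exact ha.smul hV.2

theorem mvfderiv_congr {G : Type*} [NormedAddCommGroup G] [NormedSpace ℝ G] {g g' : M → G} {p : M}
    (h : g =ᶠ[𝓝 p] g') : mvfderiv J g p = mvfderiv J g' p := by
  unfold mvfderiv
  rw [h.mfderiv_eq]
  have := h.self_of_nhds
  ext u
  rfl

theorem mvfderiv_comp_vec {G : Type*} [NormedAddCommGroup G] [NormedSpace ℝ G] {F : M → N}
    {g : N → G} {p : M} (hg : MDifferentiableAt I 𝓘(ℝ, G) g (F p))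
    (hF : MDifferentiableAt J I F p) (u : TangentSpace J p) :
    mvfderiv J (fun x => g (F x)) p u = mvfderiv I g (F p) (mfderiv J I F p u) :=
  mfderiv_comp_apply p hg hF u

theorem covDerivAlong_congr {F : M → N} {V W : Π x : M, TangentSpace I (F x)} {p : M}
    (h : ∀ᶠ x in 𝓝 p, V x = W x) (u : TangentSpace J p) :
    covDerivAlong I J F V p u = covDerivAlong I J F W p u := by
  unfold covDerivAlong
  rw [h.self_of_nhds, mvfderiv_congr (g' := fun x => toCoord I (F p) (F x) (W x))
    (h.mono fun x hx => by simp only [hx])]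

section Metric

variable [IsContMDiffRiemannianBundle I ∞ E (fun x : N => TangentSpace I x)]

theorem DiffFieldAt.inner {F : M → N} {V W : Π x : M, TangentSpace I (F x)} {p : M}
    (hV : DiffFieldAt I J F V p) (hW : DiffFieldAt I J F W p) :
    MDifferentiableAt J 𝓘(ℝ, ℝ) (fun x => ⟪V x, W x⟫_ℝ) p :=
  MDifferentiableAt.inner_bundle (IB := I) (F := E) hV hW

theorem mdifferentiableAt_inner_coordField {q : N} (u v : TangentSpace I q) :
    MDifferentiableAt I 𝓘(ℝ, ℝ) (fun x : N => ⟪coordField I u x, coordField I v x⟫_ℝ) q :=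
  (smoothFieldAt_coordField u).diffFieldAt.inner (smoothFieldAt_coordField v).diffFieldAt

theorem metricDeriv_add_mid {q : N} (w u u' v : TangentSpace I q) :
    metricDeriv I w (u + u') v = metricDeriv I w u v + metricDeriv I w u' v := by
  simp only [metricDeriv, coordField_add, inner_add_left]
  rw [mvfderiv_fun_add (mdifferentiableAt_inner_coordField u v)
    (mdifferentiableAt_inner_coordField u' v)]
  rfl

theorem metricDeriv_smul_mid {q : N} (w u v : TangentSpace I q) (c : ℝ) :
    metricDeriv I w (c • u) v = c * metricDeriv I w u v := by
  simp only [metricDeriv, coordField_smul, real_inner_smul_left]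
  rw [mvfderiv_fun_mul (f := fun _ => c) mdifferentiableAt_const
    (mdifferentiableAt_inner_coordField u v), mvfderiv_const]
  simp

theorem metricDeriv_symm {q : N} (w u v : TangentSpace I q) :
    metricDeriv I w u v = metricDeriv I w v u := by
  simp only [metricDeriv, real_inner_comm]

theorem metricDeriv_add_right {q : N} (w u v v' : TangentSpace I q) :
    metricDeriv I w u (v + v') = metricDeriv I w u v + metricDeriv I w u v' := by
  simp only [metricDeriv_symm w u, metricDeriv_add_mid]

theorem metricDeriv_smul_right {q : N} (w u v : TangentSpace I q) (c : ℝ) :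
    metricDeriv I w u (c • v) = c * metricDeriv I w u v := by
  simp only [metricDeriv_symm w u, metricDeriv_smul_mid]

theorem metricDeriv_add_left {q : N} (w w' u v : TangentSpace I q) :
    metricDeriv I (w + w') u v = metricDeriv I w u v + metricDeriv I w' u v := by
  simp [metricDeriv]

theorem metricDeriv_smul_left {q : N} (w u v : TangentSpace I q) (c : ℝ) :
    metricDeriv I (c • w) u v = c * metricDeriv I w u v := by
  simp [metricDeriv]

theorem inner_sum_stdOrthonormalBasis {T : Type*} [NormedAddCommGroup T] [InnerProductSpace ℝ T]
    [FiniteDimensional ℝ T] (l : T →ₗ[ℝ] ℝ) (z : T) :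
    ⟪∑ k, l (stdOrthonormalBasis ℝ T k) • stdOrthonormalBasis ℝ T k, z⟫_ℝ = l z := by
  conv_rhs => rw [← (stdOrthonormalBasis ℝ T).sum_repr' z]
  rw [sum_inner, map_sum]
  refine Finset.sum_congr rfl fun k _ => ?_
  rw [map_smul, real_inner_smul_left, smul_eq_mul, mul_comm]

theorem inner_christoffel {q : N} (u v z : TangentSpace I q) :
    ⟪christoffel I u v, z⟫_ℝ =
      (metricDeriv I u v z + metricDeriv I v u z - metricDeriv I z u v) / 2 := by
  let l : TangentSpace I q →ₗ[ℝ] ℝ :=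
    { toFun := fun z => (metricDeriv I u v z + metricDeriv I v u z - metricDeriv I z u v) / 2
      map_add' := fun a b => by
        simp only [metricDeriv_add_right, metricDeriv_add_left]; ring
      map_smul' := fun c a => by
        simp only [metricDeriv_smul_right, metricDeriv_smul_left, smul_eq_mul, RingHom.id_apply]
        ring }
  exact inner_sum_stdOrthonormalBasis l z

theorem christoffel_symm {q : N} (u v : TangentSpace I q) :
    christoffel I u v = christoffel I v u := by
  refine ext_inner_right ℝ fun z => ?_
  rw [inner_christoffel, inner_christoffel, metricDeriv_symm z u v]
  ring

theorem christoffel_add_left {q : N} (u u' v : TangentSpace I q) :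
    christoffel I (u + u') v = christoffel I u v + christoffel I u' v := by
  refine ext_inner_right ℝ fun z => ?_
  simp only [inner_add_left, inner_christoffel, metricDeriv_add_left, metricDeriv_add_mid]
  ring

theorem christoffel_smul_left {q : N} (u v : TangentSpace I q) (c : ℝ) :
    christoffel I (c • u) v = c • christoffel I u v := by
  refine ext_inner_right ℝ fun z => ?_
  simp only [real_inner_smul_left, inner_christoffel, metricDeriv_smul_left, metricDeriv_smul_mid]
  ring

theorem christoffel_add_right {q : N} (u v v' : TangentSpace I q) :
    christoffel I u (v + v') = christoffel I u v + christoffel I u v' := by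
  simp only [christoffel_symm u, christoffel_add_left]

theorem christoffel_smul_right {q : N} (u v : TangentSpace I q) (c : ℝ) :
    christoffel I u (c • v) = c • christoffel I u v := by
  simp only [christoffel_symm u, christoffel_smul_left]

theorem inner_christoffel_add {q : N} (w u v : TangentSpace I q) :
    ⟪christoffel I w u, v⟫_ℝ + ⟪u, christoffel I w v⟫_ℝ = metricDeriv I w u v := by
  rw [inner_christoffel, real_inner_comm, inner_christoffel,
    metricDeriv_symm u w v, metricDeriv_symm v w u, metricDeriv_symm w v u]
  ring

theorem covDerivAlong_add {F : M → N} {V W : Π x : M, TangentSpace I (F x)} {p : M}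
    (hV : DiffFieldAt I J F V p) (hW : DiffFieldAt I J F W p) (u : TangentSpace J p) :
    covDerivAlong I J F (fun x => V x + W x) p u =
      covDerivAlong I J F V p u + covDerivAlong I J F W p u := by
  rw [diffFieldAt_iff] at hV hW
  simp only [covDerivAlong, map_add, christoffel_add_right]
  rw [mvfderiv_fun_add hV.2 hW.2]
  simp only [add_apply, map_add]
  abel

theorem covDerivAlong_smul {F : M → N} {V : Π x : M, TangentSpace I (F x)} {a : M → ℝ} {p : M}
    (ha : MDifferentiableAt J 𝓘(ℝ, ℝ) a p) (hV : DiffFieldAt I J F V p) (u : TangentSpace J p) :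
    covDerivAlong I J F (fun x => a x • V x) p u =
      mvfderiv J a p u • V p + a p • covDerivAlong I J F V p u := by
  rw [diffFieldAt_iff] at hV
  simp only [covDerivAlong, map_smul, christoffel_smul_right]
  rw [mvfderiv_fun_smul ha hV.2]
  simp only [add_apply, map_add, smul_apply, map_smul,
    ContinuousLinearMap.smulRight_apply, smul_add]
  rw [show (trivializationAt E (TangentSpace I) (F p)).symmL ℝ (F p)
    ((trivializationAt E (TangentSpace I) (F p)).continuousLinearMapAt ℝ (F p) (V p)) = V p from
      ofCoord_toCoord (mem_chart_source H _) _]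
  abel

theorem covDerivAlong_comp {F : M → N} {Y : Π x : N, TangentSpace I x} {p : M}
    (hF : MDifferentiableAt J I F p) (hY : DiffFieldAt I I id Y (F p)) (u : TangentSpace J p) :
    covDerivAlong I J F (fun x => Y (F x)) p u = covDeriv I Y (F p) (mfderiv J I F p u) := by
  unfold covDerivAlong covDeriv
  have h := (diffFieldAt_iff.1 hY).2
  rw [mvfderiv_comp_vec (g := fun y => toCoord I (F p) y (Y y)) h hF u]

theorem covDerivAlong_id (Y : Π x : N, TangentSpace I x) (p : N) (u : TangentSpace I p) :
    covDerivAlong I I id Y p u = covDeriv I Y p u := by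
  unfold covDerivAlong covDeriv
  rw [mfderiv_id]
  rfl

theorem covDerivAlong_add_dir (F : M → N) (V : Π x : M, TangentSpace I (F x)) (p : M)
    (u u' : TangentSpace J p) :
    covDerivAlong I J F V p (u + u') = covDerivAlong I J F V p u + covDerivAlong I J F V p u' := by
  simp only [covDerivAlong, map_add, christoffel_add_left]
  abel

theorem covDerivAlong_smul_dir (F : M → N) (V : Π x : M, TangentSpace I (F x)) (p : M)
    (c : ℝ) (u : TangentSpace J p) :
    covDerivAlong I J F V p (c • u) = c • covDerivAlong I J F V p u := by
  simp only [covDerivAlong, map_smul, christoffel_smul_left, smul_add]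

theorem covDeriv_coordField {q : N} (u v : TangentSpace I q) :
    covDeriv I (coordField I v) q u = christoffel I u v := by
  unfold covDeriv
  rw [mvfderiv_congr (g' := fun _ => toCoord I q q v), mvfderiv_const, coordField_self]
  · simp
  · filter_upwards [chart_source_mem_nhds H q] with x hx
    exact toCoord_coordField hx v

end Metric
end Calculus

section Frames

open Filter Topology

variable {E : Type*} [NormedAddCommGroup E] [NormedSpace ℝ E] [FiniteDimensional ℝ E]
  {H : Type*} [TopologicalSpace H] {I : ModelWithCorners ℝ E H}
  {N : Type*} [TopologicalSpace N] [ChartedSpace H N] [IsManifold I ∞ N]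
  [RiemannianBundle (fun x : N => TangentSpace I x)]
  {E' : Type*} [NormedAddCommGroup E'] [NormedSpace ℝ E'] [FiniteDimensional ℝ E']
  {H' : Type*} [TopologicalSpace H'] {J : ModelWithCorners ℝ E' H'}
  {M : Type*} [TopologicalSpace M] [ChartedSpace H' M] [IsManifold J ∞ M]

theorem coordField_sum {ι : Type*} (s : Finset ι) {q : N} (v : ι → TangentSpace I q) (x : N) :
    coordField I (∑ k ∈ s, v k) x = ∑ k ∈ s, coordField I (v k) x := by
  simp [coordField]

theorem diffFieldAt_coordField_comp {F : M → N} {p : M} (hF : MDifferentiableAt J I F p)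
    (v : TangentSpace I (F p)) : DiffFieldAt I J F (fun x => coordField I v (F x)) p :=
  (smoothFieldAt_coordField v).diffFieldAt.comp hF

/-- To prove a property of all differentiable vector fields along a map, it suffices to treat the
coordinate fields and to check stability under sums and multiplication by functions. -/
theorem DiffFieldAt.induction {F : M → N} {p : M} {Q : (Π x : M, TangentSpace I (F x)) → Prop}
    (congr : ∀ V W, (∀ᶠ x in 𝓝 p, V x = W x) → Q W → Q V)
    (add : ∀ V W, DiffFieldAt I J F V p → DiffFieldAt I J F W p → Q V → Q W →
      Q (fun x => V x + W x))
    (smul : ∀ (a : M → ℝ) V, MDifferentiableAt J 𝓘(ℝ, ℝ) a p → DiffFieldAt I J F V p → Q V →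
      Q (fun x => a x • V x))
    (coord : ∀ v : TangentSpace I (F p), Q (fun x => coordField I v (F x)))
    {V : Π x : M, TangentSpace I (F x)} (hV : DiffFieldAt I J F V p) : Q V := by
  have hF := hV.mdifferentiableAt
  let b := stdOrthonormalBasis ℝ (TangentSpace I (F p))
  let c : M → TangentSpace I (F p) := fun x => ofCoord I (F p) (F p) (toCoord I (F p) (F x) (V x))
  let l : Fin _ → E →L[ℝ] ℝ := fun k => (innerSL ℝ (b k)).comp (ofCoord I (F p) (F p))
  let a : Fin _ → M → ℝ := fun k x => l k (toCoord I (F p) (F x) (V x))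
  have ha : ∀ k, MDifferentiableAt J 𝓘(ℝ, ℝ) (a k) p := fun k =>
    (l k).mdifferentiableAt.comp p (diffFieldAt_iff.1 hV).2
  have key : ∀ s : Finset (Fin _),
      DiffFieldAt I J F (fun x => ∑ k ∈ s, a k x • coordField I (b k) (F x)) p ∧
      Q (fun x => ∑ k ∈ s, a k x • coordField I (b k) (F x)) := by
    intro s
    induction s using Finset.induction_on with
    | empty =>
      have h0 := smul (fun _ => 0) _ mdifferentiableAt_const
        (diffFieldAt_coordField_comp hF 0) (coord 0)
      have h1 := (diffFieldAt_coordField_comp hF 0).smul (a := fun _ => 0) mdifferentiableAt_const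
      simp only [zero_smul] at h0 h1
      simpa using ⟨h1, h0⟩
    | insert k s hk ih =>
      simp only [Finset.sum_insert hk]
      have hd := (diffFieldAt_coordField_comp hF (b k)).smul (ha k)
      exact ⟨hd.add ih.1, add _ _ hd ih.1
        (smul _ _ (ha k) (diffFieldAt_coordField_comp hF (b k)) (coord (b k))) ih.2⟩
  refine congr _ _ ?_ (key Finset.univ).2
  filter_upwards [eventually_mem_chart (H := H) hF.continuousAt] with x hx
  have hc : ∑ k, a k x • b k = c x := b.sum_repr' (c x)
  simp only [← coordField_smul]
  rw [← coordField_sum, hc]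
  exact ((congrArg (ofCoord I (F p) (F x))
    (toCoord_ofCoord (mem_chart_source H (F p)) _)).trans (ofCoord_toCoord hx _)).symm

variable [IsContMDiffRiemannianBundle I ∞ E (fun x : N => TangentSpace I x)]

theorem mvfderiv_inner_coordField {F : M → N} {p : M} (hF : MDifferentiableAt J I F p)
    (v w : TangentSpace I (F p)) (u : TangentSpace J p) :
    mvfderiv J (fun x => ⟪coordField I v (F x), coordField I w (F x)⟫_ℝ) p u =
      metricDeriv I (mfderiv J I F p u) v w :=
  mvfderiv_comp_vec (g := fun y : N => ⟪coordField I v y, coordField I w y⟫_ℝ)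
    (mdifferentiableAt_inner_coordField v w) hF u

/-- The Levi-Civita derivative along a map is compatible with the metric. -/
theorem mvfderiv_inner {F : M → N} {V W : Π x : M, TangentSpace I (F x)} {p : M}
    (hV : DiffFieldAt I J F V p) (hW : DiffFieldAt I J F W p) (u : TangentSpace J p) :
    mvfderiv J (fun x => ⟪V x, W x⟫_ℝ) p u =
      ⟪covDerivAlong I J F V p u, W p⟫_ℝ + ⟪V p, covDerivAlong I J F W p u⟫_ℝ := by
  have hF := hV.mdifferentiableAt
  revert W
  refine DiffFieldAt.induction (Q := fun V => ∀ {W : Π x : M, TangentSpace I (F x)},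
    DiffFieldAt I J F W p → mvfderiv J (fun x => ⟪V x, W x⟫_ℝ) p u =
      ⟪covDerivAlong I J F V p u, W p⟫_ℝ + ⟪V p, covDerivAlong I J F W p u⟫_ℝ)
    ?_ ?_ ?_ ?_ hV
  · intro V V' h hQ W hW
    rw [mvfderiv_congr (g' := fun x => ⟪V' x, W x⟫_ℝ) (h.mono fun x hx => by simp only [hx]),
      hQ hW, covDerivAlong_congr h, h.self_of_nhds]
  · intro V V' hV hV' h h' W hW
    simp only [inner_add_left]
    rw [mvfderiv_fun_add (hV.inner hW) (hV'.inner hW), covDerivAlong_add hV hV', add_apply, h hW,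
      h' hW, inner_add_left]
    ring
  · intro a V ha hV h W hW
    simp only [real_inner_smul_left]
    rw [mvfderiv_fun_mul ha (hV.inner hW), covDerivAlong_smul ha hV, add_apply, smul_apply,
      smul_apply, h hW, inner_add_left, real_inner_smul_left, real_inner_smul_left]
    simp only [smul_eq_mul]
    ring
  intro v W hW
  have hv := diffFieldAt_coordField_comp hF v
  refine DiffFieldAt.induction (Q := fun W => mvfderiv J (fun x => ⟪coordField I v (F x), W x⟫_ℝ) p u
    = ⟪covDerivAlong I J F (fun x => coordField I v (F x)) p u, W p⟫_ℝ
      + ⟪coordField I v (F p), covDerivAlong I J F W p u⟫_ℝ) ?_ ?_ ?_ ?_ hW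
  · intro V V' h hQ
    rw [mvfderiv_congr (g' := fun x => ⟪coordField I v (F x), V' x⟫_ℝ)
      (h.mono fun x hx => by simp only [hx]), hQ, covDerivAlong_congr h, h.self_of_nhds]
  · intro V V' hV hV' h h'
    simp only [inner_add_right]
    rw [mvfderiv_fun_add (hv.inner hV) (hv.inner hV'), covDerivAlong_add hV hV', add_apply, h,
      h', inner_add_right]
    ring
  · intro a V ha hV h
    simp only [real_inner_smul_right]
    rw [mvfderiv_fun_mul ha (hv.inner hV), covDerivAlong_smul ha hV, add_apply, smul_apply,
      smul_apply, h, inner_add_right, real_inner_smul_right, real_inner_smul_right]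
    simp only [smul_eq_mul]
    ring
  · intro w
    rw [mvfderiv_inner_coordField hF,
      covDerivAlong_comp hF (smoothFieldAt_coordField v).diffFieldAt,
      covDerivAlong_comp hF (smoothFieldAt_coordField w).diffFieldAt,
      covDeriv_coordField, covDeriv_coordField]
    simp only [coordField_self]
    rw [inner_christoffel_add]

theorem mvfderiv_inner_self {V W : Π x : N, TangentSpace I x} {p : N}
    (hV : DiffFieldAt I I id V p) (hW : DiffFieldAt I I id W p) (u : TangentSpace I p) :
    mvfderiv I (fun x => ⟪V x, W x⟫_ℝ) p u =
      ⟪covDeriv I V p u, W p⟫_ℝ + ⟪V p, covDeriv I W p u⟫_ℝ := by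
  rw [← covDerivAlong_id V, ← covDerivAlong_id W]
  exact mvfderiv_inner (F := id) hV hW u

end Frames

section SecondDerivative

open Filter Topology

variable {E' : Type*} [NormedAddCommGroup E'] [NormedSpace ℝ E'] [FiniteDimensional ℝ E']
  {H' : Type*} [TopologicalSpace H'] {J : ModelWithCorners ℝ E' H'} [J.Boundaryless]
  {M : Type*} [TopologicalSpace M] [ChartedSpace H' M] [IsManifold J ∞ M]
  {G : Type*} [NormedAddCommGroup G] [NormedSpace ℝ G]

theorem eventually_mvfderiv_coordField {g : M → G} {p : M} (hg : ContMDiffAt J 𝓘(ℝ, G) 2 g p)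
    (v : TangentSpace J p) :
    ∀ᶠ x in 𝓝 p, mvfderiv J g x (coordField J v x) =
      fderiv ℝ (g ∘ (extChartAt J p).symm) (extChartAt J p x) (toCoord J p p v) := by
  filter_upwards [contMDiffAt_iff_contMDiffAt_nhds (by simp) |>.1 hg, chart_source_mem_nhds H' p] with x hx hxs
  have hxs' : x ∈ (extChartAt J p).source := by simpa using hxs
  have hinv : (extChartAt J p).symm (extChartAt J p x) = x := (extChartAt J p).left_inv hxs'
  have hsymm : MDifferentiableAt 𝓘(ℝ, E') J (extChartAt J p).symm (extChartAt J p x) := by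
    have := mdifferentiableWithinAt_extChartAt_symm (I := J) ((extChartAt J p).map_source hxs')
    rwa [J.range_eq_univ, mdifferentiableWithinAt_univ] at this
  have h1 : coordField J v x =
      mfderiv 𝓘(ℝ, E') J (extChartAt J p).symm (extChartAt J p x) (toCoord J p p v) := by
    unfold coordField
    rw [TangentBundle.symmL_trivializationAt hxs, J.range_eq_univ, mfderivWithin_univ]
    rfl
  have h2 := mfderiv_comp_apply_of_eq (I := 𝓘(ℝ, E')) (I' := J) (I'' := 𝓘(ℝ, G))
    (g := g) (f := (extChartAt J p).symm) (x := extChartAt J p x) (y := x)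
    (hx.mdifferentiableAt (by simp)) hsymm hinv (toCoord J p p v)
  rw [mfderiv_eq_fderiv] at h2
  rw [h1]
  exact h2.symm

theorem contDiffAt_comp_extChartAt_symm {g : M → G} {p : M} (hg : ContMDiffAt J 𝓘(ℝ, G) 2 g p) :
    ContDiffAt ℝ 2 (g ∘ (extChartAt J p).symm) (extChartAt J p p) := by
  have := (contMDiffAt_iff.1 hg).2
  rw [J.range_eq_univ, contDiffWithinAt_univ] at this
  exact this

theorem hasMFDerivAt_mvfderiv_coordField {g : M → G} {p : M} (hg : ContMDiffAt J 𝓘(ℝ, G) 2 g p)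
    (v : TangentSpace J p) :
    MDifferentiableAt J 𝓘(ℝ, G) (fun x => mvfderiv J g x (coordField J v x)) p ∧
    ∀ u : TangentSpace J p, mvfderiv J (fun x => mvfderiv J g x (coordField J v x)) p u =
      fderiv ℝ (fderiv ℝ (g ∘ (extChartAt J p).symm)) (extChartAt J p p) (toCoord J p p u)
        (toCoord J p p v) := by
  have he := eventually_mvfderiv_coordField hg v
  set g' := g ∘ (extChartAt J p).symm with hg'
  have hd : DifferentiableAt ℝ (fderiv ℝ g') (extChartAt J p p) :=
    ((contDiffAt_comp_extChartAt_symm hg).fderiv_right (m := 1) (by norm_num)).differentiableAt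
      (by simp)
  let k : E' → G := fun y => fderiv ℝ g' y (toCoord J p p v)
  have hk : DifferentiableAt ℝ k (extChartAt J p p) :=
    hd.clm_apply (differentiableAt_const _)
  have hx : MDifferentiableAt J 𝓘(ℝ, E') (extChartAt J p) p :=
    mdifferentiableAt_extChartAt (mem_chart_source H' p)
  refine ⟨(MDifferentiableAt.comp (g := k) p hk.mdifferentiableAt hx).congr_of_eventuallyEq he, ?_⟩
  intro u
  rw [mvfderiv_congr he]
  have h2 := mfderiv_comp_apply (I := J) (I' := 𝓘(ℝ, E')) (I'' := 𝓘(ℝ, G)) (g := k) p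
    hk.mdifferentiableAt hx u
  rw [mfderiv_eq_fderiv, ← TangentBundle.continuousLinearMapAt_trivializationAt
    (mem_chart_source H' p)] at h2
  refine h2.trans ?_
  have h3 : HasFDerivAt k _ (extChartAt J p p) :=
    (ContinuousLinearMap.apply ℝ G (toCoord J p p v)).hasFDerivAt.comp _ hd.hasFDerivAt
  rw [h3.fderiv]
  rfl

/-- Second derivatives of a function in coordinate directions commute. -/
theorem mvfderiv_mvfderiv_coordField_symm {g : M → G} {p : M} (hg : ContMDiffAt J 𝓘(ℝ, G) 2 g p)
    (u v : TangentSpace J p) :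
    mvfderiv J (fun x => mvfderiv J g x (coordField J v x)) p u =
      mvfderiv J (fun x => mvfderiv J g x (coordField J u x)) p v := by
  rw [(hasMFDerivAt_mvfderiv_coordField hg v).2, (hasMFDerivAt_mvfderiv_coordField hg u).2]
  exact (contDiffAt_comp_extChartAt_symm hg).isSymmSndFDerivAt (by simp) _ _

end SecondDerivative

section Torsion

open Filter Topology

variable {E : Type*} [NormedAddCommGroup E] [NormedSpace ℝ E] [FiniteDimensional ℝ E]
  {H : Type*} [TopologicalSpace H] {I : ModelWithCorners ℝ E H} [I.Boundaryless]
  {N : Type*} [TopologicalSpace N] [ChartedSpace H N] [IsManifold I ∞ N]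
  [RiemannianBundle (fun x : N => TangentSpace I x)]
  [IsContMDiffRiemannianBundle I ∞ E (fun x : N => TangentSpace I x)]

theorem mpullbackWithin_extChartAt_symm_eventuallyEq (X : Π x : N, TangentSpace I x) (q : N) :
    (mpullbackWithin 𝓘(ℝ, E) I (extChartAt I q).symm X (Set.range I) : E → E) =ᶠ[𝓝 (extChartAt I q q)]
      (fun x => toCoord I q x (X x)) ∘ (extChartAt I q).symm := by
  filter_upwards [extChartAt_target_mem_nhds (I := I) q] with y hy
  have h1 := mfderiv_extChartAt_comp_mfderivWithin_extChartAt_symm hy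
  have h2 := mfderivWithin_extChartAt_symm_comp_mfderiv_extChartAt hy
  have hs : (extChartAt I q).symm y ∈ (chartAt H q).source := by
    simpa using (extChartAt I q).map_target hy
  simp only [mpullbackWithin_apply, Function.comp_apply]
  rw [ContinuousLinearMap.inverse_eq h2 h1, toCoord,
    TangentBundle.continuousLinearMapAt_trivializationAt hs]
  rfl

theorem fderiv_comp_extChartAt_symm {G : Type*} [NormedAddCommGroup G] [NormedSpace ℝ G] {g : N → G}
    {q : N} (hg : MDifferentiableAt I 𝓘(ℝ, G) g q) :
    (fderiv ℝ (g ∘ (extChartAt I q).symm) (extChartAt I q q) : E →L[ℝ] G) = mvfderiv I g q := by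
  rw [hg.mvfderiv, I.range_eq_univ, fderivWithin_univ]
  rfl

/-- The Levi-Civita connection is torsion free. -/
theorem covDeriv_sub_covDeriv {X Y : Π x : N, TangentSpace I x} {q : N}
    (hX : DiffFieldAt I I id X q) (hY : DiffFieldAt I I id Y q) :
    covDeriv I Y q (X q) - covDeriv I X q (Y q) = mlieBracket I X Y q := by
  have hX' := (diffFieldAt_iff.1 hX).2
  have hY' := (diffFieldAt_iff.1 hY).2
  have eX := mpullbackWithin_extChartAt_symm_eventuallyEq X q
  have eY := mpullbackWithin_extChartAt_symm_eventuallyEq Y q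
  have id_q : ∀ v : E, ofCoord I q q v = v := fun v => by
    rw [ofCoord, TangentBundle.symmL_trivializationAt (mem_chart_source H q),
      mfderivWithin_range_extChartAt_symm]
    rfl
  have hq : (extChartAt I q).symm (extChartAt I q q) = q := extChartAt_to_inv q
  have val : ∀ Z : Π x : N, TangentSpace I x, mpullbackWithin 𝓘(ℝ, E) I (extChartAt I q).symm Z
      (Set.range I) (extChartAt I q q) = (Z q : E) := fun Z => by
    refine (mpullbackWithin_extChartAt_symm_eventuallyEq Z q).self_of_nhds.trans ?_
    refine (congrArg (fun x => toCoord I q x (Z x)) hq).trans ?_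
    rw [← id_q (toCoord I q q (Z q))]
    exact ofCoord_toCoord (mem_chart_source H q) (Z q)
  have hinv : ∀ w : E, (mfderiv I 𝓘(ℝ, E) (extChartAt I q) q).inverse w = w := fun w => by
    rw [mfderiv_extChartAt_self]
    change (ContinuousLinearMap.id ℝ E).inverse w = w
    rw [ContinuousLinearMap.inverse_id]
    rfl
  have hbr : (mlieBracket I X Y q : E) = mvfderiv I (fun x => toCoord I q x (Y x)) q (X q) -
      mvfderiv I (fun x => toCoord I q x (X x)) q (Y q) := by
    rw [← mlieBracketWithin_univ, mlieBracketWithin_apply]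
    refine (hinv _).trans ?_
    rw [Set.preimage_univ, Set.univ_inter]
    conv_lhs => enter [4]; rw [I.range_eq_univ]
    refine (congrFun (lieBracketWithin_univ (𝕜 := ℝ) (E := E)) _).trans ?_
    have hX'' := fderiv_comp_extChartAt_symm (g := fun x => toCoord I q x (X x)) hX'
    have hY'' := fderiv_comp_extChartAt_symm (g := fun x => toCoord I q x (Y x)) hY'
    exact congrArg₂ (· - ·)
      ((congr (congrArg DFunLike.coe eY.fderiv_eq) (val X)).trans (DFunLike.congr_fun hY'' (X q)))
      ((congr (congrArg DFunLike.coe eX.fderiv_eq) (val Y)).trans (DFunLike.congr_fun hX'' (Y q)))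
  refine Eq.trans ?_ hbr.symm
  unfold covDeriv
  rw [christoffel_symm (X q), add_sub_add_right_eq_sub]
  exact congrArg₂ (· - ·) (id_q _) (id_q _)

end Torsion

section ContactAlgebra

variable {V : Type*} [NormedAddCommGroup V] [InnerProductSpace ℝ V]

/-- An almost contact metric structure on a vector space. -/
structure IsAlmostContact (φ : V →ₗ[ℝ] V) (ξ : V) (η : V →ₗ[ℝ] ℝ) : Prop where
  φ_φ : ∀ v, φ (φ v) = -v + η v • ξ
  η_ξ : η ξ = 1
  inner_φ_φ : ∀ u v, ⟪φ u, φ v⟫_ℝ = ⟪u, v⟫_ℝ - η u * η v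

namespace IsAlmostContact

variable {φ : V →ₗ[ℝ] V} {ξ : V} {η : V →ₗ[ℝ] ℝ} (h : IsAlmostContact φ ξ η)
include h

theorem ξ_ne_zero : ξ ≠ 0 := fun h0 => by
  have := h.η_ξ
  simp [h0] at this

theorem η_φ (v : V) : η (φ v) = 0 := by
  have h1 := h.φ_φ (φ v)
  rw [h.φ_φ v, map_add, map_neg, map_smul] at h1
  have h2 : φ ξ = η (φ ξ) • ξ := by
    have h3 := h.φ_φ (φ ξ)
    have h4 : φ (φ ξ) = 0 := by rw [h.φ_φ, h.η_ξ]; simp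
    rw [h4, map_zero] at h3
    exact (neg_add_eq_zero.1 h3.symm)
  have h5 : η (φ ξ) = 0 := by
    have h4 : φ (φ ξ) = 0 := by rw [h.φ_φ, h.η_ξ]; simp
    rw [h2, map_smul, h2, smul_smul] at h4
    simpa [h.ξ_ne_zero, h.η_ξ] using h4
  rw [h2, h5, zero_smul, smul_zero, add_zero] at h1
  have h6 : η (φ v) • ξ = 0 := by simpa using h1.symm
  simpa [h.ξ_ne_zero] using h6

theorem φ_ξ : φ ξ = 0 := by
  have h4 : φ (φ ξ) = 0 := by rw [h.φ_φ, h.η_ξ]; simp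
  have h3 := h.φ_φ (φ ξ)
  rw [h4, h.η_φ] at h3
  simpa using h3.symm

theorem η_apply (v : V) : η v = ⟪ξ, v⟫_ℝ := by
  have := h.inner_φ_φ ξ v
  rw [h.φ_ξ, h.η_ξ, inner_zero_left] at this
  linarith

theorem inner_ξ_ξ : ⟪ξ, ξ⟫_ℝ = 1 := by rw [← h.η_apply, h.η_ξ]

theorem inner_ξ_φ (v : V) : ⟪ξ, φ v⟫_ℝ = 0 := by rw [← h.η_apply, h.η_φ]

theorem inner_φ_left (u v : V) : ⟪φ u, v⟫_ℝ = -⟪u, φ v⟫_ℝ := by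
  have := h.inner_φ_φ (φ u) v
  rw [h.φ_φ, h.η_φ, inner_add_left, real_inner_smul_left, h.inner_ξ_φ, inner_neg_left] at this
  linarith

end IsAlmostContact

/-- The pointwise first order conditions at the root of the formula for `∇ φ` on a normal almost
contact metric manifold with `dη = κ Φ` and `dΦ = 0`, where `P u v = (∇_u φ) v` and `D u = ∇_u ξ`. -/
structure IsNormalJet (φ : V →ₗ[ℝ] V) (ξ : V) (η : V →ₗ[ℝ] ℝ) (P : V →ₗ[ℝ] V →ₗ[ℝ] V)
    (D : V →ₗ[ℝ] V) (κ : ℝ) : Prop where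
  inner_D_ξ : ∀ u, ⟪D u, ξ⟫_ℝ = 0
  φ_D : ∀ u, φ (D u) = -P u ξ
  skew : ∀ u v w, ⟪P u v, w⟫_ℝ = -⟪v, P u w⟫_ℝ
  P_φ : ∀ u v, P u (φ v) + φ (P u v) = ⟪D u, v⟫_ℝ • ξ + η v • D u
  normal : ∀ u v, P (φ u) v - P (φ v) u + φ (P v u) - φ (P u v)
    + (⟪D u, v⟫_ℝ - ⟪D v, u⟫_ℝ) • ξ = 0
  closed : ∀ u v w, ⟪v, P u w⟫_ℝ + ⟪w, P v u⟫_ℝ + ⟪u, P w v⟫_ℝ = 0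
  dη : ∀ u v, ⟪D u, v⟫_ℝ - ⟪D v, u⟫_ℝ = 2 * κ * ⟪u, φ v⟫_ℝ

namespace IsNormalJet

variable {φ : V →ₗ[ℝ] V} {ξ : V} {η : V →ₗ[ℝ] ℝ} {P : V →ₗ[ℝ] V →ₗ[ℝ] V} {D : V →ₗ[ℝ] V} {κ : ℝ}

theorem D_eq_and_P_eq (h : IsAlmostContact φ ξ η) (j : IsNormalJet φ ξ η P D κ) :
    (∀ u, D u = -κ • φ u) ∧ ∀ u v, P u v = κ • (⟪u, v⟫_ℝ • ξ - η v • u) := by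
  have skew : ∀ u v w, ⟪P u v, w⟫_ℝ = -⟪P u w, v⟫_ℝ := fun u v w => by
    rw [real_inner_comm v]; exact j.skew u v w
  have cyc : ∀ u v w, ⟪P u v, w⟫_ℝ + ⟪P v w, u⟫_ℝ + ⟪P w u, v⟫_ℝ = 0 := fun u v w => by
    have := j.closed u v w
    simp only [real_inner_comm _ v, real_inner_comm _ w, real_inner_comm _ u] at this
    linarith [skew u v w, skew v w u, skew w u v]
  have p_ξ : ∀ u w, ⟪P u ξ, w⟫_ℝ = ⟪D u, φ w⟫_ℝ := fun u w => by
    have h1 : P u ξ = -φ (D u) := by rw [j.φ_D, neg_neg]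
    rw [h1, inner_neg_left, h.inner_φ_left, neg_neg]
  have p_φ : ∀ u v w, ⟪P u (φ v), w⟫_ℝ - ⟪P u v, φ w⟫_ℝ = ⟪D u, v⟫_ℝ * η w + η v * ⟪D u, w⟫_ℝ := by
    intro u v w
    have := congrArg (fun x => ⟪x, w⟫_ℝ) (j.P_φ u v)
    simp only [inner_add_left, real_inner_smul_left, h.inner_φ_left, ← h.η_apply] at this
    linarith
  have normal : ∀ u v w, ⟪P (φ u) v, w⟫_ℝ - ⟪P (φ v) u, w⟫_ℝ - ⟪P v u, φ w⟫_ℝ + ⟪P u v, φ w⟫_ℝ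
      + (⟪D u, v⟫_ℝ - ⟪D v, u⟫_ℝ) * η w = 0 := by
    intro u v w
    have := congrArg (fun x => ⟪x, w⟫_ℝ) (j.normal u v)
    simp only [inner_add_left, inner_sub_left, real_inner_smul_left, h.inner_φ_left, ← h.η_apply,
      inner_zero_left] at this
    linarith
  have D_φφ : ∀ u w, ⟪D u, φ (φ w)⟫_ℝ = -⟪D u, w⟫_ℝ := fun u w => by
    rw [h.φ_φ, inner_add_right, real_inner_smul_right, j.inner_D_ξ, inner_neg_right]; ring
  have P_ξ : ∀ u v, ⟪P ξ u, v⟫_ℝ = ⟪D u, φ v⟫_ℝ - ⟪D v, φ u⟫_ℝ := fun u v => by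
    have := cyc ξ u v
    rw [skew u v ξ, p_ξ, p_ξ] at this
    linarith
  have D_ξ : ∀ u, ⟪D ξ, u⟫_ℝ = 0 := fun u => by
    have h1 := j.dη ξ u
    rw [h.inner_ξ_φ, j.inner_D_ξ] at h1
    linarith
  have anti : ∀ u w, ⟪D (φ u), φ w⟫_ℝ + ⟪D (φ w), φ u⟫_ℝ = 0 := fun u w => by
    have h1 := normal u ξ w
    rw [p_ξ, h.φ_ξ, p_ξ, P_ξ, j.inner_D_ξ, D_ξ, map_zero, LinearMap.zero_apply,
      inner_zero_left] at h1
    linarith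
  have D_φ : ∀ u w, ⟪D (φ u), φ w⟫_ℝ = κ * ⟪u, φ w⟫_ℝ := fun u w => by
    have h1 := j.dη (φ u) (φ w)
    rw [h.inner_φ_φ, h.η_φ] at h1
    linarith [anti u w]
  have D_eq : ∀ u w, ⟪D u, w⟫_ℝ = κ * ⟪u, φ w⟫_ℝ := fun u w => by
    have h1 := D_φ (φ u) (φ w)
    rw [h.inner_φ_φ, h.η_φ, h.φ_φ u, map_add, map_neg, map_smul, inner_add_left,
      real_inner_smul_left, inner_neg_left, D_ξ, D_φφ] at h1
    linarith
  refine ⟨fun u => ext_inner_right ℝ fun w => ?_, fun u v => ext_inner_right ℝ fun w => ?_⟩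
  · rw [D_eq, real_inner_smul_left, h.inner_φ_left]
    ring
  let q : V → V → V → ℝ := fun u v w => ⟪P u v, w⟫_ℝ - κ * (⟪u, v⟫_ℝ * η w - η v * ⟪u, w⟫_ℝ)
  have q_def : ∀ u v w, q u v w =
    ⟪P u v, w⟫_ℝ - κ * (⟪u, v⟫_ℝ * η w - η v * ⟪u, w⟫_ℝ) := fun _ _ _ => rfl
  have q_skew : ∀ u v w, q u v w = -q u w v := fun u v w => by
    rw [q_def, q_def, skew]; ring
  have q_cyc : ∀ u v w, q u v w + q v w u + q w u v = 0 := fun u v w => by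
    rw [q_def, q_def, q_def, real_inner_comm u v, real_inner_comm v w, real_inner_comm u w]
    linear_combination cyc u v w
  have q_φ : ∀ u v w, q u (φ v) w = q u v (φ w) := fun u v w => by
    have h1 := p_φ u v w
    rw [D_eq, D_eq] at h1
    rw [q_def, q_def, h.η_φ, h.η_φ]
    linear_combination h1
  have q_normal : ∀ u v w, q (φ u) v w - q (φ v) u w - q v u (φ w) + q u v (φ w) = 0 := by
    intro u v w
    have h1 := normal u v w
    rw [D_eq, D_eq] at h1
    simp only [q_def, h.η_φ, h.inner_φ_left]
    rw [real_inner_comm (φ u) v, h.inner_φ_left] at *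
    linear_combination h1
  have q_zero : ∀ u v w, q w u (φ v) = 0 := by
    intro u v w
    have h1 := q_normal u v w
    have h2 := q_cyc (φ u) v w
    have h3 := q_cyc (φ v) u w
    rw [q_φ] at h2 h3
    have h4 := q_skew v w (φ u)
    have h5 := q_skew u w (φ v)
    have h6 := q_skew w u (φ v)
    rw [q_φ] at h4 h5 h6
    linarith
  have q_ξ : q u v ξ = 0 := by
    rw [q_def, h.η_ξ, skew, p_ξ, D_eq, h.φ_φ, inner_add_right, real_inner_smul_right,
      real_inner_comm ξ u, ← h.η_apply, inner_neg_right]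
    ring
  have q_w : q u v w = 0 := by
    have h1 := q_zero v (φ w) u
    rw [q_def, h.φ_φ] at h1
    rw [q_def] at q_ξ ⊢
    simp only [inner_add_right, inner_neg_right, real_inner_smul_right, map_add, map_neg, map_smul,
      smul_eq_mul] at h1 q_ξ
    linear_combination -h1 + η w * q_ξ
  rw [q_def] at q_w
  rw [real_inner_smul_left, inner_sub_left, real_inner_smul_left, real_inner_smul_left,
    ← h.η_apply]
  linarith

end IsNormalJet
end ContactAlgebra

section ContactManifold

open Filter Topology

variable {E : Type*} [NormedAddCommGroup E] [NormedSpace ℝ E] [FiniteDimensional ℝ E]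
  {H : Type*} [TopologicalSpace H] {I : ModelWithCorners ℝ E H}
  {N : Type*} [TopologicalSpace N] [ChartedSpace H N] [IsManifold I ∞ N]
  [RiemannianBundle (fun x : N => TangentSpace I x)]
  [IsContMDiffRiemannianBundle I ∞ E (fun x : N => TangentSpace I x)]
  {E' : Type*} [NormedAddCommGroup E'] [NormedSpace ℝ E'] [FiniteDimensional ℝ E']
  {H' : Type*} [TopologicalSpace H'] {J : ModelWithCorners ℝ E' H'}
  {M : Type*} [TopologicalSpace M] [ChartedSpace H' M] [IsManifold J ∞ M]

namespace AlmostContactMetric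

variable (S : AlmostContactMetric I N)

theorem isAlmostContact (q : N) :
    IsAlmostContact (S.φ q).toLinearMap (S.ξ q) (S.η q).toLinearMap :=
  ⟨S.φ_φ q, S.η_ξ q, S.inner_φ_φ q⟩

theorem φ_ξ (q : N) : S.φ q (S.ξ q) = 0 := (S.isAlmostContact q).φ_ξ

theorem η_apply (q : N) (v : TangentSpace I q) : S.η q v = ⟪S.ξ q, v⟫_ℝ :=
  (S.isAlmostContact q).η_apply v

theorem inner_φ_left (q : N) (u v : TangentSpace I q) : ⟪S.φ q u, v⟫_ℝ = -⟪u, S.φ q v⟫_ℝ :=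
  (S.isAlmostContact q).inner_φ_left u v

theorem diffFieldAt_φ {F : M → N} {V : Π x : M, TangentSpace I (F x)} {p : M}
    (hV : DiffFieldAt I J F V p) : DiffFieldAt I J F (fun x => S.φ (F x) (V x)) p :=
  MDifferentiableAt.clm_bundle_apply (F₁ := E) (F₂ := E)
    (MDifferentiableAt.comp p (S.contMDiff_φ.mdifferentiableAt (by simp)) hV.mdifferentiableAt) hV

theorem diffFieldAt_φField {Y : Π x : N, TangentSpace I x} {q : N} (hY : DiffFieldAt I I id Y q) :
    DiffFieldAt I I id (S.φField Y) q :=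
  S.diffFieldAt_φ hY

theorem smoothFieldAt_ξ (q : N) : SmoothFieldAt I S.ξ q := S.contMDiff_ξ q

theorem diffFieldAt_ξ (q : N) : DiffFieldAt I I id S.ξ q := (S.smoothFieldAt_ξ q).diffFieldAt

/-- The covariant derivative `(∇_w φ) v` of the structure tensor `φ`. -/
noncomputable def nablaφ (q : N) :
    TangentSpace I q →ₗ[ℝ] TangentSpace I q →ₗ[ℝ] TangentSpace I q :=
  LinearMap.mk₂ ℝ (fun w v => covDeriv I (S.φField (coordField I v)) q w
      - S.φ q (covDeriv I (coordField I v) q w))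
    (fun w w' v => by
      simp only [← covDerivAlong_id, covDerivAlong_add_dir, map_add]
      exact add_sub_add_comm _ _ _ _)
    (fun c w v => by
      simp only [← covDerivAlong_id, covDerivAlong_smul_dir, map_smul, smul_sub])
    (fun w v v' => by
      have hv := (smoothFieldAt_coordField v).diffFieldAt
      have hv' := (smoothFieldAt_coordField v').diffFieldAt
      have h1 : S.φField (coordField I (v + v')) =
          fun x => S.φField (coordField I v) x + S.φField (coordField I v') x := by
        funext x
        simp only [φField, coordField_add, map_add]
      have h2 : coordField I (v + v') = fun x => coordField I v x + coordField I v' x :=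
        funext fun x => coordField_add v v' x
      rw [h1, h2]
      simp only [← covDerivAlong_id]
      rw [covDerivAlong_add (S.diffFieldAt_φField hv) (S.diffFieldAt_φField hv'),
        covDerivAlong_add hv hv', map_add]
      exact add_sub_add_comm _ _ _ _)
    (fun c w v => by
      simp only [covDeriv_coordField]
      have hv := (smoothFieldAt_coordField v).diffFieldAt
      have h1 : S.φField (coordField I (c • v)) =
          fun x => c • S.φField (coordField I v) x := by
        funext x
        simp only [φField, coordField_smul, map_smul]
      rw [h1, christoffel_smul_right, map_smul]
      simp only [← covDerivAlong_id]
      rw [covDerivAlong_smul (a := fun _ => c) mdifferentiableAt_const (S.diffFieldAt_φField hv),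
        mvfderiv_const]
      simp [smul_sub])

theorem nablaφ_apply (q : N) (w v : TangentSpace I q) :
    S.nablaφ q w v = covDeriv I (S.φField (coordField I v)) q w
      - S.φ q (covDeriv I (coordField I v) q w) := rfl

/-- The covariant derivative `∇_w ξ`. -/
noncomputable def nablaξ (q : N) : TangentSpace I q →ₗ[ℝ] TangentSpace I q where
  toFun w := covDeriv I S.ξ q w
  map_add' w w' := by simp only [← covDerivAlong_id, covDerivAlong_add_dir]
  map_smul' c w := by simp only [← covDerivAlong_id, covDerivAlong_smul_dir, RingHom.id_apply]

theorem nablaξ_apply (q : N) (w : TangentSpace I q) : S.nablaξ q w = covDeriv I S.ξ q w := rfl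

/-- The Leibniz rule for `φ V`, with `V` a vector field along a map. -/
theorem covDerivAlong_φ {F : M → N} {V : Π x : M, TangentSpace I (F x)} {p : M}
    (hV : DiffFieldAt I J F V p) (u : TangentSpace J p) :
    covDerivAlong I J F (fun x => S.φ (F x) (V x)) p u =
      S.nablaφ (F p) (mfderiv J I F p u) (V p) + S.φ (F p) (covDerivAlong I J F V p u) := by
  have hF := hV.mdifferentiableAt
  refine DiffFieldAt.induction (Q := fun V => covDerivAlong I J F (fun x => S.φ (F x) (V x)) p u =
      S.nablaφ (F p) (mfderiv J I F p u) (V p) + S.φ (F p) (covDerivAlong I J F V p u))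
    ?_ ?_ ?_ ?_ hV
  · intro V W h hW
    rw [covDerivAlong_congr (W := fun x => S.φ (F x) (W x)) (h.mono fun x hx => by rw [hx]), hW,
      covDerivAlong_congr h, h.self_of_nhds]
  · intro V W hV hW h h'
    simp only [map_add]
    rw [covDerivAlong_add (S.diffFieldAt_φ hV) (S.diffFieldAt_φ hW), h, h',
      covDerivAlong_add hV hW, map_add]
    abel
  · intro a V ha hV h
    simp only [map_smul]
    rw [covDerivAlong_smul ha (S.diffFieldAt_φ hV), h, covDerivAlong_smul ha hV, map_add, map_smul,
      map_smul, smul_add]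
    abel
  · intro v
    have hv := (smoothFieldAt_coordField v).diffFieldAt
    rw [covDerivAlong_comp hF hv,
      covDerivAlong_comp (Y := fun y => S.φ y (coordField I v y)) hF (S.diffFieldAt_φ hv)]
    simp only [coordField_self]
    rw [nablaφ_apply]
    exact (sub_add_cancel _ _).symm

theorem covDeriv_φField {Y : Π x : N, TangentSpace I x} {q : N} (hY : DiffFieldAt I I id Y q)
    (u : TangentSpace I q) :
    covDeriv I (S.φField Y) q u = S.nablaφ q u (Y q) + S.φ q (covDeriv I Y q u) := by
  have := S.covDerivAlong_φ hY u
  rw [mfderiv_id] at this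
  rw [← covDerivAlong_id, ← covDerivAlong_id]
  exact this

theorem φField_coordField_self {q : N} (v : TangentSpace I q) :
    S.φField (coordField I v) q = S.φ q v := by
  rw [φField, coordField_self]

theorem inner_nablaξ_ξ (q : N) (u : TangentSpace I q) : ⟪S.nablaξ q u, S.ξ q⟫_ℝ = 0 := by
  have h := mvfderiv_inner_self (S.diffFieldAt_ξ q) (S.diffFieldAt_ξ q) u
  have h1 : (fun x => ⟪S.ξ x, S.ξ x⟫_ℝ) = fun _ => (1 : ℝ) :=
    funext fun x => (S.isAlmostContact x).inner_ξ_ξ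
  rw [h1, mvfderiv_const, real_inner_comm (covDeriv I S.ξ q u)] at h
  rw [nablaξ_apply]
  simp only [zero_apply] at h
  rw [real_inner_comm] at h ⊢
  linarith

theorem φ_nablaξ (q : N) (u : TangentSpace I q) :
    S.φ q (S.nablaξ q u) = -S.nablaφ q u (S.ξ q) := by
  have h := S.covDeriv_φField (S.diffFieldAt_ξ q) u
  have h1 : S.φField S.ξ = fun x => (0 : ℝ) • S.ξ x := by
    funext x
    rw [φField, φ_ξ, zero_smul]
  rw [h1, ← covDerivAlong_id, covDerivAlong_smul (a := fun _ => (0 : ℝ)) mdifferentiableAt_const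
    (S.diffFieldAt_ξ q), mvfderiv_const] at h
  rw [nablaξ_apply]
  simp only [zero_apply, zero_smul, add_zero] at h
  exact eq_neg_of_add_eq_zero_right h.symm

theorem nablaφ_skew (q : N) (u v w : TangentSpace I q) :
    ⟪S.nablaφ q u v, w⟫_ℝ = -⟪v, S.nablaφ q u w⟫_ℝ := by
  have hv := (smoothFieldAt_coordField v).diffFieldAt
  have hw := (smoothFieldAt_coordField w).diffFieldAt
  have h1 := mvfderiv_inner_self (S.diffFieldAt_φField hv) hw u
  have h2 := mvfderiv_inner_self hv (S.diffFieldAt_φField hw) u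
  have h3 : (fun x => ⟪S.φField (coordField I v) x, coordField I w x⟫_ℝ) =
      fun x => -⟪coordField I v x, S.φField (coordField I w) x⟫_ℝ :=
    funext fun x => S.inner_φ_left x _ _
  rw [h3, mvfderiv_fun_neg, neg_apply, h2] at h1
  rw [S.covDeriv_φField hv, S.covDeriv_φField hw] at h1
  simp only [coordField_self, φField_coordField_self, inner_add_left, inner_add_right,
    inner_φ_left] at h1
  linarith

theorem nablaφ_φ (q : N) (u v : TangentSpace I q) :
    S.nablaφ q u (S.φ q v) + S.φ q (S.nablaφ q u v) =
      ⟪S.nablaξ q u, v⟫_ℝ • S.ξ q + S.η q v • S.nablaξ q u := by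
  have hv := (smoothFieldAt_coordField v).diffFieldAt
  have hξ := S.diffFieldAt_ξ q
  have h1 := S.covDeriv_φField (S.diffFieldAt_φField hv) u
  rw [S.covDeriv_φField hv, φField_coordField_self, coordField_self] at h1
  have hη : MDifferentiableAt I 𝓘(ℝ, ℝ) (fun x => ⟪S.ξ x, coordField I v x⟫_ℝ) q := hξ.inner hv
  have h2 : S.φField (S.φField (coordField I v)) = fun x => (-1 : ℝ) • coordField I v x +
      ⟪S.ξ x, coordField I v x⟫_ℝ • S.ξ x := by
    funext x
    rw [φField, φField, S.φ_φ, S.η_apply, neg_one_smul]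
  have h3 : covDeriv I (S.φField (S.φField (coordField I v))) q u =
      -covDeriv I (coordField I v) q u + ((⟪S.nablaξ q u, v⟫_ℝ
        + ⟪S.ξ q, covDeriv I (coordField I v) q u⟫_ℝ) • S.ξ q + S.η q v • S.nablaξ q u) := by
    rw [h2, ← covDerivAlong_id, covDerivAlong_add
      (hv.smul (a := fun _ => (-1 : ℝ)) mdifferentiableAt_const) (hξ.smul hη),
      covDerivAlong_smul (a := fun _ => (-1 : ℝ)) mdifferentiableAt_const hv,
      covDerivAlong_smul hη hξ, mvfderiv_const, mvfderiv_inner_self hξ hv]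
    simp only [coordField_self, covDerivAlong_id, zero_apply, zero_smul, neg_one_smul, zero_add,
      nablaξ_apply, S.η_apply]
  rw [h3, map_add, S.φ_φ, S.η_apply q (covDeriv I _ q u), add_smul] at h1
  have h4 : S.nablaφ q u (S.φ q v) + S.φ q (S.nablaφ q u v)
      = (-covDeriv I (coordField I v) q u + (⟪S.nablaξ q u, v⟫_ℝ • S.ξ q
        + ⟪S.ξ q, covDeriv I (coordField I v) q u⟫_ℝ • S.ξ q + S.η q v • S.nablaξ q u))
        - (-covDeriv I (coordField I v) q u
          + ⟪S.ξ q, covDeriv I (coordField I v) q u⟫_ℝ • S.ξ q) := by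
    rw [h1]; abel
  rw [h4]; abel

end AlmostContactMetric
end ContactManifold

section StructureClasses

open Filter Topology

variable {E : Type*} [NormedAddCommGroup E] [NormedSpace ℝ E] [FiniteDimensional ℝ E]
  {H : Type*} [TopologicalSpace H] {I : ModelWithCorners ℝ E H} [I.Boundaryless]
  {N : Type*} [TopologicalSpace N] [ChartedSpace H N] [IsManifold I ∞ N]
  [RiemannianBundle (fun x : N => TangentSpace I x)]
  [IsContMDiffRiemannianBundle I ∞ E (fun x : N => TangentSpace I x)]

theorem coordField_eq_mpullback {q y : N} (hy : y ∈ (chartAt H q).source) (u : TangentSpace I q) :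
    coordField I u y = mpullback I 𝓘(ℝ, E) (extChartAt I q)
      (fun _ : E => (toCoord I q q u : E)) y := by
  have hy' : y ∈ (extChartAt I q).source := by simpa using hy
  have h := ContinuousLinearMap.inverse_eq
    (mfderiv_extChartAt_comp_mfderivWithin_extChartAt_symm' hy')
    (mfderivWithin_extChartAt_symm_comp_mfderiv_extChartAt' hy')
  rw [coordField, TangentBundle.symmL_trivializationAt hy]
  exact (DFunLike.congr_fun h _).symm

theorem mlieBracket_coordField {q y : N} (hy : y ∈ (chartAt H q).source) (u v : TangentSpace I q) :
    mlieBracket I (coordField I u) (coordField I v) y = 0 := by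
  have h : ∀ w : TangentSpace I q, coordField I w =ᶠ[𝓝 y]
      mpullback I 𝓘(ℝ, E) (extChartAt I q) (fun _ : E => (toCoord I q q w : E)) := fun w => by
    filter_upwards [(chartAt H q).open_source.mem_nhds hy] with x hx
    exact coordField_eq_mpullback hx w
  have hc : ∀ c : E, MDifferentiableAt 𝓘(ℝ, E) (𝓘(ℝ, E).prod 𝓘(ℝ, E))
      (fun x : E => (⟨x, c⟩ : TangentBundle 𝓘(ℝ, E) E)) (extChartAt I q y) := fun c =>
    ContMDiffAt.mdifferentiableAt (n := 1)
      ((contMDiffAt_vectorSpace_iff_contDiffAt (V := fun _ : E => c)).2 contDiffAt_const) (by simp)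
  have : IsManifold I (minSmoothness ℝ 2) N := by
    rw [minSmoothness_of_isRCLikeNormedField]; infer_instance
  rw [(h u).mlieBracket_vectorField_eq (h v), ← mpullback_mlieBracket (n := ∞) (hc _) (hc _)
    (contMDiffAt_extChartAt' hy) (by rw [minSmoothness_of_isRCLikeNormedField]; exact ENat.LEInfty.out), mpullback_apply]
  have h0 : (mlieBracket 𝓘(ℝ, E) (fun _ : E => (toCoord I q q u : E))
      (fun _ : E => (toCoord I q q v : E)) (extChartAt I q y) : E) = 0 := by
    have h1 : ∀ X Y : Π x : E, TangentSpace 𝓘(ℝ, E) x, mlieBracket 𝓘(ℝ, E) X Y =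
        lieBracket ℝ X Y := fun X Y => by
      rw [← mlieBracketWithin_univ, mlieBracketWithin_eq_lieBracketWithin]
      exact lieBracketWithin_univ (𝕜 := ℝ) (E := E)
    refine (congrFun (h1 _ _) _).trans ?_
    simp [lieBracket]
    rfl
  exact (congrArg _ h0).trans (map_zero _)

theorem mlieBracket_coordField_self {q : N} (u v : TangentSpace I q) :
    mlieBracket I (coordField I u) (coordField I v) q = 0 :=
  mlieBracket_coordField (mem_chart_source H q) u v

namespace AlmostContactMetric

variable (S : AlmostContactMetric I N)

theorem contMDiffAt_η_coordField {q : N} (v : TangentSpace I q) :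
    ContMDiffAt I 𝓘(ℝ, ℝ) ∞ (fun x => S.η x (coordField I v x)) q := by
  simp only [S.η_apply]
  exact ContMDiffAt.inner_bundle (IB := I) (F := E) (S.smoothFieldAt_ξ q)
    (smoothFieldAt_coordField v)

theorem mvfderiv_η_coordField {q : N} (u v : TangentSpace I q) :
    mvfderiv I (fun x => S.η x (coordField I v x)) q u =
      ⟪S.nablaξ q u, v⟫_ℝ + ⟪S.ξ q, christoffel I u v⟫_ℝ := by
  simp only [S.η_apply]
  rw [mvfderiv_inner_self (S.diffFieldAt_ξ q) (smoothFieldAt_coordField v).diffFieldAt,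
    coordField_self, covDeriv_coordField, nablaξ_apply]

theorem dη_coordField {q : N} (u v : TangentSpace I q) :
    S.dη (coordField I u) (coordField I v) q =
      (⟪S.nablaξ q u, v⟫_ℝ - ⟪S.nablaξ q v, u⟫_ℝ) / 2 := by
  rw [dη, mlieBracket_coordField_self, map_zero, coordField_self, coordField_self,
    mvfderiv_η_coordField, mvfderiv_η_coordField, christoffel_symm v u]
  ring

theorem mvfderiv_fundForm_coordField {q : N} (u v w : TangentSpace I q) :
    mvfderiv I (S.fundForm (coordField I v) (coordField I w)) q u =
      ⟪christoffel I u v, S.φ q w⟫_ℝ + ⟪v, S.nablaφ q u w⟫_ℝ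
        + ⟪v, S.φ q (christoffel I u w)⟫_ℝ := by
  have hw := (smoothFieldAt_coordField w).diffFieldAt
  have h := mvfderiv_inner_self (smoothFieldAt_coordField v).diffFieldAt
    (S.diffFieldAt_φField hw) u
  rw [S.covDeriv_φField hw, inner_add_right, covDeriv_coordField, covDeriv_coordField,
    φField_coordField_self, coordField_self, coordField_self, ← add_assoc] at h
  exact h

theorem cyclic_mvfderiv_fundForm_coordField {q : N} (u v w : TangentSpace I q) :
    mvfderiv I (S.fundForm (coordField I v) (coordField I w)) q u
      + mvfderiv I (S.fundForm (coordField I w) (coordField I u)) q v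
      + mvfderiv I (S.fundForm (coordField I u) (coordField I v)) q w =
      ⟪v, S.nablaφ q u w⟫_ℝ + ⟪w, S.nablaφ q v u⟫_ℝ + ⟪u, S.nablaφ q w v⟫_ℝ := by
  simp only [mvfderiv_fundForm_coordField]
  have h : ∀ a b c : TangentSpace I q, ⟪a, S.φ q (christoffel I b c)⟫_ℝ =
      -⟪christoffel I c b, S.φ q a⟫_ℝ := fun a b c => by
    rw [real_inner_comm, inner_φ_left, christoffel_symm b c]
  simp only [h]
  ring

theorem dΦ_coordField {q : N} (u v w : TangentSpace I q) :
    S.dΦ (coordField I u) (coordField I v) (coordField I w) q =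
      (⟪v, S.nablaφ q u w⟫_ℝ + ⟪w, S.nablaφ q v u⟫_ℝ + ⟪u, S.nablaφ q w v⟫_ℝ) / 3 := by
  rw [dΦ]
  simp only [coordField_self]
  rw [cyclic_mvfderiv_fundForm_coordField]
  simp only [fundForm, mlieBracket_coordField_self, inner_zero_left, sub_zero]

theorem nijenhuis_coordField {q : N} (u v : TangentSpace I q) (w : TangentSpace I q) :
    ⟪S.nijenhuis (coordField I u) (coordField I v) q, w⟫_ℝ =
      ⟪S.nablaφ q (S.φ q u) v - S.nablaφ q (S.φ q v) u + S.φ q (S.nablaφ q v u)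
        - S.φ q (S.nablaφ q u v), w⟫_ℝ := by
  have hu := (smoothFieldAt_coordField u).diffFieldAt
  have hv := (smoothFieldAt_coordField v).diffFieldAt
  rw [nijenhuis, mlieBracket_coordField_self,
    ← covDeriv_sub_covDeriv (S.diffFieldAt_φField hu) (S.diffFieldAt_φField hv),
    ← covDeriv_sub_covDeriv (S.diffFieldAt_φField hu) hv,
    ← covDeriv_sub_covDeriv hu (S.diffFieldAt_φField hv)]
  simp only [φField_coordField_self, coordField_self, S.covDeriv_φField hu, S.covDeriv_φField hv,
    covDeriv_coordField, inner_add_left, inner_sub_left, map_zero, inner_zero_left,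
    inner_φ_left]
  rw [christoffel_symm v u]
  ring

theorem isNormalJet (hN : S.IsNormal) {κ : ℝ} {q : N}
    (hη : ∀ u v : TangentSpace I q, ⟪S.nablaξ q u, v⟫_ℝ - ⟪S.nablaξ q v, u⟫_ℝ =
      2 * κ * ⟪u, S.φ q v⟫_ℝ)
    (hΦ : ∀ u v w : TangentSpace I q,
      ⟪v, S.nablaφ q u w⟫_ℝ + ⟪w, S.nablaφ q v u⟫_ℝ + ⟪u, S.nablaφ q w v⟫_ℝ = 0) :
    IsNormalJet (S.φ q).toLinearMap (S.ξ q) (S.η q).toLinearMap (S.nablaφ q) (S.nablaξ q) κ where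
  inner_D_ξ := S.inner_nablaξ_ξ q
  φ_D := S.φ_nablaξ q
  skew := S.nablaφ_skew q
  P_φ := S.nablaφ_φ q
  normal u v := by
    refine ext_inner_right ℝ fun w => ?_
    have h := congrArg (fun x => ⟪x, w⟫_ℝ)
      (hN q _ _ (smoothFieldAt_coordField u) (smoothFieldAt_coordField v))
    simp only [inner_add_left, inner_zero_left] at h ⊢
    rw [nijenhuis_coordField, dη_coordField, mul_div_cancel₀ _ two_ne_zero] at h
    exact h
  closed := hΦ
  dη := hη

theorem mvfderiv_const_mul_sub {f g : N → ℝ} {q : N} (hf : MDifferentiableAt I 𝓘(ℝ, ℝ) f q)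
    (hg : MDifferentiableAt I 𝓘(ℝ, ℝ) g q) (u : TangentSpace I q) :
    mvfderiv I (fun x => (1 / 2 : ℝ) * (f x - g x)) q u =
      (mvfderiv I f q u - mvfderiv I g q u) / 2 := by
  rw [mvfderiv_fun_mul (f := fun _ => (1 / 2 : ℝ)) (g := fun x => f x - g x)
    mdifferentiableAt_const (hf.sub hg), mvfderiv_const, mvfderiv_fun_sub hf hg]
  simp
  ring

theorem IsContact.mvfderiv_fundForm {S : AlmostContactMetric I N} (h : S.IsContact) {q : N}
    (u v w : TangentSpace I q) :
    mvfderiv I (S.fundForm (coordField I v) (coordField I w)) q u =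
      (mvfderiv I (fun x => mvfderiv I (fun y => S.η y (coordField I w y)) x (coordField I v x)) q u
      - mvfderiv I (fun x => mvfderiv I (fun y => S.η y (coordField I v y)) x (coordField I w x))
        q u) / 2 := by
  have hsm : ∀ a : TangentSpace I q, ContMDiffAt I 𝓘(ℝ, ℝ) 2 (fun x => S.η x (coordField I a x)) q :=
    fun a => (S.contMDiffAt_η_coordField a).of_le ENat.LEInfty.out
  rw [← mvfderiv_const_mul_sub (hasMFDerivAt_mvfderiv_coordField (hsm w) v).1
    (hasMFDerivAt_mvfderiv_coordField (hsm v) w).1]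
  refine DFunLike.congr_fun (mvfderiv_congr ?_) u
  have hs : ∀ a : TangentSpace I q, ∀ᶠ x in 𝓝 q, SmoothFieldAt I (coordField I a) x := fun a => by
    filter_upwards [chart_source_mem_nhds H q] with x hx
    refine ((trivializationAt E (TangentSpace I) q).contMDiffOn_section_baseSet_iff.2 ?_).contMDiffAt
      ((trivializationAt E (TangentSpace I) q).open_baseSet.mem_nhds (by simpa using hx))
    refine (contMDiffOn_const (c := toCoord I q q a)).congr fun y hy => ?_
    rw [← toCoord_coordField (by simpa using hy) a, toCoord,
      Trivialization.continuousLinearMapAt_apply, Trivialization.coe_linearMapAt_of_mem _ hy]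
  filter_upwards [hs v, hs w, chart_source_mem_nhds H q] with x hv hw hx
  rw [h x _ _ hv hw, dη, mlieBracket_coordField hx, map_zero]
  ring

theorem IsContact.cyclic {S : AlmostContactMetric I N} (h : S.IsContact) {q : N}
    (u v w : TangentSpace I q) :
    ⟪v, S.nablaφ q u w⟫_ℝ + ⟪w, S.nablaφ q v u⟫_ℝ + ⟪u, S.nablaφ q w v⟫_ℝ = 0 := by
  have hsm : ∀ a : TangentSpace I q, ContMDiffAt I 𝓘(ℝ, ℝ) 2 (fun x => S.η x (coordField I a x)) q :=
    fun a => (S.contMDiffAt_η_coordField a).of_le ENat.LEInfty.out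
  rw [← cyclic_mvfderiv_fundForm_coordField, h.mvfderiv_fundForm, h.mvfderiv_fundForm,
    h.mvfderiv_fundForm, mvfderiv_mvfderiv_coordField_symm (hsm u) w v,
    mvfderiv_mvfderiv_coordField_symm (hsm v) w u, mvfderiv_mvfderiv_coordField_symm (hsm w) v u]
  ring

/-- The first order behaviour at a point of a trans-Sasakian structure of type `(κ, μ)`. -/
def TransSasakianAt (κ μ : ℝ) (q : N) : Prop :=
  (∀ u v : TangentSpace I q, S.nablaφ q u v =
    κ • (⟪u, v⟫_ℝ • S.ξ q - S.η q v • u) + μ • (⟪S.φ q u, v⟫_ℝ • S.ξ q - S.η q v • S.φ q u)) ∧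
  ∀ u : TangentSpace I q, S.nablaξ q u = -κ • S.φ q u + μ • (u - S.η q u • S.ξ q)

theorem transSasakianAt_of_isNormalJet {κ : ℝ} {q : N}
    (h : IsNormalJet (S.φ q).toLinearMap (S.ξ q) (S.η q).toLinearMap (S.nablaφ q) (S.nablaξ q) κ) :
    S.TransSasakianAt κ 0 q := by
  obtain ⟨h1, h2⟩ := IsNormalJet.D_eq_and_P_eq (S.isAlmostContact q) h
  refine ⟨fun u v => ?_, fun u => ?_⟩
  · rw [zero_smul, add_zero]; exact h2 u v
  · rw [zero_smul, add_zero]; exact h1 u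

theorem IsSasakian.transSasakianAt {S : AlmostContactMetric I N} (h : S.IsSasakian) (q : N) :
    S.TransSasakianAt 1 0 q := by
  refine S.transSasakianAt_of_isNormalJet (S.isNormalJet h.2 (fun u v => ?_) h.1.cyclic)
  have := h.1 q _ _ (smoothFieldAt_coordField u) (smoothFieldAt_coordField v)
  rw [dη_coordField, fundForm, coordField_self, coordField_self] at this
  linarith

theorem IsCosymplectic.transSasakianAt {S : AlmostContactMetric I N} (h : S.IsCosymplectic)
    (q : N) : S.TransSasakianAt 0 0 q := by
  refine S.transSasakianAt_of_isNormalJet (S.isNormalJet h.2 (fun u v => ?_) fun u v w => ?_)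
  · have := h.1.1 q _ _ (smoothFieldAt_coordField u) (smoothFieldAt_coordField v)
    rw [dη_coordField] at this
    linarith
  · have := h.1.2 q _ _ _ (smoothFieldAt_coordField u) (smoothFieldAt_coordField v)
      (smoothFieldAt_coordField w)
    rw [dΦ_coordField] at this
    linarith

theorem IsKenmotsu.transSasakianAt {S : AlmostContactMetric I N} (h : S.IsKenmotsu) (q : N) :
    S.TransSasakianAt 0 1 q := by
  have hP : ∀ u v : TangentSpace I q, S.nablaφ q u v =
      ⟪S.φ q u, v⟫_ℝ • S.ξ q - S.η q v • S.φ q u := fun u v => by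
    have := h q _ _ (smoothFieldAt_coordField u) (smoothFieldAt_coordField v)
    rw [coordField_self, coordField_self] at this
    exact this
  refine ⟨fun u v => ?_, fun u => ?_⟩
  · rw [zero_smul, zero_add, one_smul, hP]
  have h1 := S.φ_nablaξ q u
  rw [hP, S.inner_φ_left, φ_ξ, inner_zero_right, neg_zero, zero_smul, S.η_ξ, one_smul] at h1
  have h2 := congrArg (S.φ q) h1
  rw [S.φ_φ, S.η_apply q (S.nablaξ q u), real_inner_comm, S.inner_nablaξ_ξ, zero_smul] at h2
  simp only [zero_sub, neg_neg, S.φ_φ, add_zero] at h2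
  rw [neg_zero, zero_smul, zero_add, one_smul, ← neg_neg (S.nablaξ q u), h2]
  refine ext_inner_right ℝ fun w => ?_
  simp only [inner_add_left, inner_sub_left, inner_neg_left]
  ring

end AlmostContactMetric
end StructureClasses

section Submanifold

open Filter Topology

variable {E : Type*} [NormedAddCommGroup E] [NormedSpace ℝ E] [FiniteDimensional ℝ E]
  {H : Type*} [TopologicalSpace H] {I : ModelWithCorners ℝ E H}
  {N : Type*} [TopologicalSpace N] [ChartedSpace H N] [IsManifold I ∞ N]
  [RiemannianBundle (fun x : N => TangentSpace I x)]
  [IsContMDiffRiemannianBundle I ∞ E (fun x : N => TangentSpace I x)]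
  {E' : Type*} [NormedAddCommGroup E'] [NormedSpace ℝ E'] [FiniteDimensional ℝ E']
  {H' : Type*} [TopologicalSpace H'] {J : ModelWithCorners ℝ E' H'} [J.Boundaryless]
  {M : Type*} [TopologicalSpace M] [ChartedSpace H' M] [IsManifold J ∞ M]
  [RiemannianBundle (fun x : M => TangentSpace J x)]
  {i : M → N}

theorem contMDiffAt_extChartAt_comp (hi : ContMDiff J I ∞ i) (p : M) :
    ContMDiffAt J 𝓘(ℝ, E) 2 (fun x => extChartAt I (i p) (i x)) p :=
  (ContMDiffAt.comp (n := ∞) p (contMDiffAt_extChartAt (I := I)) (hi p)).of_le ENat.LEInfty.out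

theorem eventually_toCoord_mfderiv (hi : ContMDiff J I ∞ i) {p : M} (v : TangentSpace J p) :
    ∀ᶠ x in 𝓝 p, toCoord I (i p) (i x) (mfderiv J I i x (coordField J v x)) =
      mvfderiv J (fun x => extChartAt I (i p) (i x)) x (coordField J v x) := by
  filter_upwards [eventually_mem_chart (H := H) hi.continuous.continuousAt] with x hx
  rw [mvfderiv_comp_vec (mdifferentiableAt_extChartAt hx) (hi.mdifferentiableAt (by simp)), toCoord,
    TangentBundle.continuousLinearMapAt_trivializationAt hx]
  rfl

theorem diffFieldAt_mfderiv_coordField (hi : ContMDiff J I ∞ i) {p : M} (v : TangentSpace J p) :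
    DiffFieldAt I J i (fun x => mfderiv J I i x (coordField J v x)) p :=
  diffFieldAt_iff.2 ⟨hi.mdifferentiableAt (by simp),
    (hasMFDerivAt_mvfderiv_coordField (contMDiffAt_extChartAt_comp hi p) v).1.congr_of_eventuallyEq
      (eventually_toCoord_mfderiv hi v)⟩

/-- The ambient covariant derivative `∇_u v`, for a coordinate field of the submanifold with
value `v`. -/
noncomputable def ambientDeriv (hi : ContMDiff J I ∞ i) (p : M) :
    TangentSpace J p →ₗ[ℝ] TangentSpace J p →ₗ[ℝ] TangentSpace I (i p) :=
  LinearMap.mk₂ ℝ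
    (fun u v => covDerivAlong I J i (fun x => mfderiv J I i x (coordField J v x)) p u)
    (fun u u' v => covDerivAlong_add_dir i _ p u u')
    (fun c u v => covDerivAlong_smul_dir i _ p c u)
    (fun u v v' => by
      simp only [coordField_add, map_add]
      exact covDerivAlong_add (diffFieldAt_mfderiv_coordField hi v)
        (diffFieldAt_mfderiv_coordField hi v') u)
    (fun c u v => by
      simp only [coordField_smul, map_smul]
      rw [covDerivAlong_smul (a := fun _ => c) mdifferentiableAt_const
        (diffFieldAt_mfderiv_coordField hi v), mvfderiv_const]
      simp)

theorem ambientDeriv_apply (hi : ContMDiff J I ∞ i) (p : M) (u v : TangentSpace J p) :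
    ambientDeriv hi p u v =
      covDerivAlong I J i (fun x => mfderiv J I i x (coordField J v x)) p u := rfl

theorem ambientDeriv_symm (hi : ContMDiff J I ∞ i) (p : M) (u v : TangentSpace J p) :
    ambientDeriv hi p u v = ambientDeriv hi p v u := by
  simp only [ambientDeriv_apply, covDerivAlong]
  rw [mvfderiv_congr (eventually_toCoord_mfderiv hi v),
    mvfderiv_congr (eventually_toCoord_mfderiv hi u),
    mvfderiv_mvfderiv_coordField_symm (contMDiffAt_extChartAt_comp hi p), coordField_self,
    coordField_self, christoffel_symm]

theorem metricDeriv_eq_inner_ambientDeriv (hi : IsIsometricImmersion I J i) {p : M}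
    (u v w : TangentSpace J p) :
    metricDeriv J u v w = ⟪ambientDeriv hi.contMDiff p u v, mfderiv J I i p w⟫_ℝ
      + ⟪mfderiv J I i p v, ambientDeriv hi.contMDiff p u w⟫_ℝ := by
  have h := mvfderiv_inner (diffFieldAt_mfderiv_coordField hi.contMDiff v)
    (diffFieldAt_mfderiv_coordField hi.contMDiff w) u
  simp only [hi.inner_mfderiv, coordField_self] at h
  exact h

/-- The Koszul formula for the tangential part of the ambient derivative. -/
theorem inner_ambientDeriv (hi : IsIsometricImmersion I J i) {p : M} (u v w : TangentSpace J p) :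
    ⟪ambientDeriv hi.contMDiff p u v, mfderiv J I i p w⟫_ℝ =
      (metricDeriv J u v w + metricDeriv J v u w - metricDeriv J w u v) / 2 := by
  simp only [metricDeriv_eq_inner_ambientDeriv hi, real_inner_comm (ambientDeriv hi.contMDiff p _ _)]
  rw [ambientDeriv_symm _ p v u, ambientDeriv_symm _ p w u, ambientDeriv_symm _ p w v]
  ring

theorem inner_nablaφ_of_eventually (hi : ContMDiff J I ∞ i) (S : AlmostContactMetric I N) {p : M}
    (u v w : TangentSpace J p)
    (h : ∀ᶠ x in 𝓝 p, ⟪S.φ (i x) (mfderiv J I i x (coordField J v x)),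
      mfderiv J I i x (coordField J w x)⟫_ℝ = 0) :
    ⟪S.nablaφ (i p) (mfderiv J I i p u) (mfderiv J I i p v), mfderiv J I i p w⟫_ℝ
      + ⟪S.φ (i p) (ambientDeriv hi p u v), mfderiv J I i p w⟫_ℝ
      + ⟪S.φ (i p) (mfderiv J I i p v), ambientDeriv hi p u w⟫_ℝ = 0 := by
  have hv := diffFieldAt_mfderiv_coordField hi v
  have h1 := mvfderiv_inner (S.diffFieldAt_φ hv) (diffFieldAt_mfderiv_coordField hi w) u
  rw [mvfderiv_congr (g' := fun _ => (0 : ℝ)) h, mvfderiv_const, S.covDerivAlong_φ hv,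
    inner_add_left] at h1
  simp only [coordField_self] at h1
  exact h1.symm

theorem inner_nablaξ_of_eventually (hi : ContMDiff J I ∞ i) (S : AlmostContactMetric I N) {p : M}
    (u w : TangentSpace J p)
    (h : ∀ᶠ x in 𝓝 p, ⟪S.ξ (i x), mfderiv J I i x (coordField J w x)⟫_ℝ = 0) :
    ⟪S.nablaξ (i p) (mfderiv J I i p u), mfderiv J I i p w⟫_ℝ
      + ⟪S.ξ (i p), ambientDeriv hi p u w⟫_ℝ = 0 := by
  have hi' : MDifferentiableAt J I i p := hi.mdifferentiableAt (by simp)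
  have h1 := mvfderiv_inner ((S.diffFieldAt_ξ (i p)).comp hi')
    (diffFieldAt_mfderiv_coordField hi w) u
  rw [mvfderiv_congr (g' := fun _ => (0 : ℝ)) h, mvfderiv_const,
    covDerivAlong_comp hi' (S.diffFieldAt_ξ (i p))] at h1
  simp only [coordField_self] at h1
  exact h1.symm

theorem inner_grad (F : M → ℝ) (p : M) (v : TangentSpace J p) :
    ⟪grad J F p, v⟫_ℝ = mvfderiv J F p v :=
  inner_sum_stdOrthonormalBasis (mvfderiv J F p).toLinearMap v

end Submanifold

section WarpedProduct

open Filter Topology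

variable {EB : Type*} [NormedAddCommGroup EB] [NormedSpace ℝ EB] [FiniteDimensional ℝ EB]
  {HB : Type*} [TopologicalSpace HB] {IB : ModelWithCorners ℝ EB HB}
  {B : Type*} [TopologicalSpace B] [ChartedSpace HB B] [IsManifold IB ∞ B]
  {EF : Type*} [NormedAddCommGroup EF] [NormedSpace ℝ EF] [FiniteDimensional ℝ EF]
  {HF : Type*} [TopologicalSpace HF] {IF : ModelWithCorners ℝ EF HF}
  {F : Type*} [TopologicalSpace F] [ChartedSpace HF F] [IsManifold IF ∞ F]

variable [RiemannianBundle (fun x : B => TangentSpace IB x)]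
  [IsContMDiffRiemannianBundle IB ∞ EB (fun x : B => TangentSpace IB x)]
  [RiemannianBundle (fun x : F => TangentSpace IF x)]
  [IsContMDiffRiemannianBundle IF ∞ EF (fun x : F => TangentSpace IF x)]
  [RiemannianBundle (fun p : B × F => TangentSpace (IB.prod IF) p)]
  {f : B → ℝ}

theorem toCoord_mfderiv_fst {p x : B × F} (hx : x ∈ (chartAt (ModelProd HB HF) p).source)
    (w : TangentSpace (IB.prod IF) x) :
    toCoord IB p.1 x.1 (mfderiv (IB.prod IF) IB (Prod.fst : B × F → B) x w) =
      (toCoord (IB.prod IF) p x w).1 := by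
  have hx1 : x.1 ∈ (chartAt HB p.1).source := by
    rw [prodChartedSpace_chartAt] at hx
    exact hx.1
  rw [toCoord, toCoord, TangentBundle.continuousLinearMapAt_trivializationAt hx,
    TangentBundle.continuousLinearMapAt_trivializationAt hx1]
  have h1 := mfderiv_comp_apply (I := IB.prod IF) (I' := IB) (I'' := 𝓘(ℝ, EB)) (f := Prod.fst)
    (g := extChartAt IB p.1) x (mdifferentiableAt_extChartAt hx1) mdifferentiableAt_fst w
  have h2 := mfderiv_comp_apply (I := IB.prod IF) (I' := 𝓘(ℝ, EB × EF)) (I'' := 𝓘(ℝ, EB))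
    (f := extChartAt (IB.prod IF) p) (g := Prod.fst) x
    differentiableAt_fst.mdifferentiableAt (mdifferentiableAt_extChartAt hx) w
  have h3 : (Prod.fst ∘ extChartAt (IB.prod IF) p : B × F → EB) = extChartAt IB p.1 ∘ Prod.fst := by
    rw [extChartAt_prod]
    rfl
  rw [mfderiv_eq_fderiv, fderiv_fst, h3] at h2
  exact h1.symm.trans h2

theorem toCoord_mfderiv_snd {p x : B × F} (hx : x ∈ (chartAt (ModelProd HB HF) p).source)
    (w : TangentSpace (IB.prod IF) x) :
    toCoord IF p.2 x.2 (mfderiv (IB.prod IF) IF (Prod.snd : B × F → F) x w) =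
      (toCoord (IB.prod IF) p x w).2 := by
  have hx1 : x.2 ∈ (chartAt HF p.2).source := by
    rw [prodChartedSpace_chartAt] at hx
    exact hx.2
  rw [toCoord, toCoord, TangentBundle.continuousLinearMapAt_trivializationAt hx,
    TangentBundle.continuousLinearMapAt_trivializationAt hx1]
  have h1 := mfderiv_comp_apply (I := IB.prod IF) (I' := IF) (I'' := 𝓘(ℝ, EF)) (f := Prod.snd)
    (g := extChartAt IF p.2) x (mdifferentiableAt_extChartAt hx1) mdifferentiableAt_snd w
  have h2 := mfderiv_comp_apply (I := IB.prod IF) (I' := 𝓘(ℝ, EB × EF)) (I'' := 𝓘(ℝ, EF))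
    (f := extChartAt (IB.prod IF) p) (g := Prod.snd) x
    differentiableAt_snd.mdifferentiableAt (mdifferentiableAt_extChartAt hx) w
  have h3 : (Prod.snd ∘ extChartAt (IB.prod IF) p : B × F → EF) = extChartAt IF p.2 ∘ Prod.snd := by
    rw [extChartAt_prod]
    rfl
  rw [mfderiv_eq_fderiv, fderiv_snd, h3] at h2
  exact h1.symm.trans h2

theorem mfderiv_fst_coordField {p x : B × F} (hx : x ∈ (chartAt (ModelProd HB HF) p).source)
    (v : TangentSpace (IB.prod IF) p) :
    mfderiv (IB.prod IF) IB (Prod.fst : B × F → B) x (coordField (IB.prod IF) v x) =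
      coordField IB (mfderiv (IB.prod IF) IB (Prod.fst : B × F → B) p v) x.1 := by
  have hx1 : x.1 ∈ (chartAt HB p.1).source := by
    rw [prodChartedSpace_chartAt] at hx
    exact hx.1
  rw [← ofCoord_toCoord hx1 (mfderiv (IB.prod IF) IB (Prod.fst : B × F → B) x
    (coordField (IB.prod IF) v x)), toCoord_mfderiv_fst hx, toCoord_coordField hx,
    ← toCoord_mfderiv_fst (mem_chart_source _ p)]
  rfl

theorem mfderiv_snd_coordField {p x : B × F} (hx : x ∈ (chartAt (ModelProd HB HF) p).source)
    (v : TangentSpace (IB.prod IF) p) :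
    mfderiv (IB.prod IF) IF (Prod.snd : B × F → F) x (coordField (IB.prod IF) v x) =
      coordField IF (mfderiv (IB.prod IF) IF (Prod.snd : B × F → F) p v) x.2 := by
  have hx1 : x.2 ∈ (chartAt HF p.2).source := by
    rw [prodChartedSpace_chartAt] at hx
    exact hx.2
  rw [← ofCoord_toCoord hx1 (mfderiv (IB.prod IF) IF (Prod.snd : B × F → F) x
    (coordField (IB.prod IF) v x)), toCoord_mfderiv_snd hx, toCoord_coordField hx,
    ← toCoord_mfderiv_snd (mem_chart_source _ p)]
  rfl

theorem coordField_zero {q : B} (x : B) : coordField IB (0 : TangentSpace IB q) x = 0 := by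
  simp [coordField]

theorem coordField_mem_baseDistribution {p x : B × F}
    (hx : x ∈ (chartAt (ModelProd HB HF) p).source) {v : TangentSpace (IB.prod IF) p}
    (hv : v ∈ baseDistribution IB IF p) : coordField (IB.prod IF) v x ∈ baseDistribution IB IF x := by
  have hv' : mfderiv (IB.prod IF) IF (Prod.snd : B × F → F) p v = 0 := hv
  change mfderiv (IB.prod IF) IF (Prod.snd : B × F → F) x _ = 0
  rw [mfderiv_snd_coordField hx, hv', coordField_zero]

theorem coordField_mem_fiberDistribution {p x : B × F}
    (hx : x ∈ (chartAt (ModelProd HB HF) p).source) {v : TangentSpace (IB.prod IF) p}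
    (hv : v ∈ fiberDistribution IB IF p) :
    coordField (IB.prod IF) v x ∈ fiberDistribution IB IF x := by
  have hv' : mfderiv (IB.prod IF) IB (Prod.fst : B × F → B) p v = 0 := hv
  change mfderiv (IB.prod IF) IB (Prod.fst : B × F → B) x _ = 0
  rw [mfderiv_fst_coordField hx, hv', coordField_zero]

theorem finrank_fiberDistribution (p : B × F) :
    Module.finrank ℝ (fiberDistribution IB IF p) = Module.finrank ℝ EF := by
  have h := LinearMap.finrank_range_add_finrank_ker
    (mfderiv (IB.prod IF) IB (Prod.fst : B × F → B) p).toLinearMap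
  have h1 : LinearMap.range (mfderiv (IB.prod IF) IB (Prod.fst : B × F → B) p).toLinearMap = ⊤ := by
    rw [mfderiv_fst]
    exact LinearMap.range_eq_top.2 Prod.fst_surjective
  rw [h1, finrank_top] at h
  change Module.finrank ℝ EB + Module.finrank ℝ (fiberDistribution IB IF p)
    = Module.finrank ℝ (EB × EF) at h
  rw [Module.finrank_prod] at h
  omega

namespace IsWarpedProduct

variable (hf : IsWarpedProduct IB IF (F := F) f)
include hf

theorem mdifferentiableAt (q : B) : MDifferentiableAt IB 𝓘(ℝ, ℝ) f q :=
  hf.contMDiff.mdifferentiableAt (by simp)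

theorem mvfderiv_log (p : B × F) (w : TangentSpace (IB.prod IF) p) :
    mvfderiv (IB.prod IF) (fun q : B × F => Real.log (f q.1)) p w =
      mvfderiv IB f p.1 (mfderiv (IB.prod IF) IB (Prod.fst : B × F → B) p w) / f p.1 := by
  have h1 : MDifferentiableAt (IB.prod IF) 𝓘(ℝ, ℝ) (fun q : B × F => f q.1) p :=
    MDifferentiableAt.comp p (hf.mdifferentiableAt p.1) mdifferentiableAt_fst
  have h2 := mvfderiv_comp_vec (F := fun q : B × F => f q.1) (I := 𝓘(ℝ, ℝ)) (g := Real.log) (p := p)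
    (Real.differentiableAt_log (hf.pos p.1).ne').mdifferentiableAt h1 w
  rw [h2, ← mvfderiv_comp_vec (F := (Prod.fst : B × F → B)) (hf.mdifferentiableAt p.1)
    mdifferentiableAt_fst w, div_eq_inv_mul]
  have h3 : ∀ s : ℝ,
      mvfderiv 𝓘(ℝ, ℝ) Real.log (f p.1) s = (f p.1)⁻¹ * s := fun s => by
    unfold mvfderiv
    rw [(Real.hasDerivAt_log (hf.pos p.1).ne').hasFDerivAt.hasMFDerivAt.mfderiv]
    change s * (f p.1)⁻¹ = _
    rw [mul_comm]
  exact h3 _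

theorem metricDeriv_eq {p : B × F} (w u v : TangentSpace (IB.prod IF) p) :
    metricDeriv (IB.prod IF) w u v =
      metricDeriv IB (mfderiv (IB.prod IF) IB (Prod.fst : B × F → B) p w)
        (mfderiv (IB.prod IF) IB (Prod.fst : B × F → B) p u)
        (mfderiv (IB.prod IF) IB (Prod.fst : B × F → B) p v)
      + (2 * mvfderiv (IB.prod IF) (fun q : B × F => Real.log (f q.1)) p w * (f p.1 ^ 2 *
        ⟪mfderiv (IB.prod IF) IF (Prod.snd : B × F → F) p u,
          mfderiv (IB.prod IF) IF (Prod.snd : B × F → F) p v⟫_ℝ)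
      + f p.1 ^ 2 * metricDeriv IF (mfderiv (IB.prod IF) IF (Prod.snd : B × F → F) p w)
        (mfderiv (IB.prod IF) IF (Prod.snd : B × F → F) p u)
        (mfderiv (IB.prod IF) IF (Prod.snd : B × F → F) p v)) := by
  set u₁ := mfderiv (IB.prod IF) IB (Prod.fst : B × F → B) p u with hu₁
  set v₁ := mfderiv (IB.prod IF) IB (Prod.fst : B × F → B) p v with hv₁
  set u₂ := mfderiv (IB.prod IF) IF (Prod.snd : B × F → F) p u with hu₂
  set v₂ := mfderiv (IB.prod IF) IF (Prod.snd : B × F → F) p v with hv₂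
  let gB : B → ℝ := fun y => ⟪coordField IB u₁ y, coordField IB v₁ y⟫_ℝ
  let gF : F → ℝ := fun y => ⟪coordField IF u₂ y, coordField IF v₂ y⟫_ℝ
  have hgB : MDifferentiableAt IB 𝓘(ℝ, ℝ) gB p.1 := mdifferentiableAt_inner_coordField u₁ v₁
  have hgF : MDifferentiableAt IF 𝓘(ℝ, ℝ) gF p.2 := mdifferentiableAt_inner_coordField u₂ v₂
  have hB : MDifferentiableAt (IB.prod IF) 𝓘(ℝ, ℝ) (fun x : B × F => gB x.1) p :=
    MDifferentiableAt.comp p hgB mdifferentiableAt_fst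
  have hF : MDifferentiableAt (IB.prod IF) 𝓘(ℝ, ℝ) (fun x : B × F => gF x.2) p :=
    MDifferentiableAt.comp p hgF mdifferentiableAt_snd
  have hf1 : MDifferentiableAt (IB.prod IF) 𝓘(ℝ, ℝ) (fun x : B × F => f x.1) p :=
    MDifferentiableAt.comp p (hf.mdifferentiableAt p.1) mdifferentiableAt_fst
  have hf2 : MDifferentiableAt (IB.prod IF) 𝓘(ℝ, ℝ) (fun x : B × F => f x.1 * f x.1) p :=
    hf1.mul hf1
  have hf2F : MDifferentiableAt (IB.prod IF) 𝓘(ℝ, ℝ)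
      (fun x : B × F => f x.1 * f x.1 * gF x.2) p := hf2.mul hF
  have key : (fun x : B × F => ⟪coordField (IB.prod IF) u x, coordField (IB.prod IF) v x⟫_ℝ)
      =ᶠ[𝓝 p] fun x => gB x.1 + f x.1 * f x.1 * gF x.2 := by
    filter_upwards [chart_source_mem_nhds (ModelProd HB HF) p] with x hx
    rw [hf.inner_eq, mfderiv_fst_coordField hx, mfderiv_fst_coordField hx,
      mfderiv_snd_coordField hx, mfderiv_snd_coordField hx, pow_two]
  rw [metricDeriv, mvfderiv_congr key, mvfderiv_fun_add hB hf2F, mvfderiv_fun_mul hf2 hF,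
    mvfderiv_fun_mul hf1 hf1]
  have e1 := mvfderiv_comp_vec (F := (Prod.fst : B × F → B)) hgB mdifferentiableAt_fst w
  have e2 := mvfderiv_comp_vec (F := (Prod.snd : B × F → F)) hgF mdifferentiableAt_snd w
  have e3 := mvfderiv_comp_vec (F := (Prod.fst : B × F → B)) (hf.mdifferentiableAt p.1)
    mdifferentiableAt_fst w
  have hp := (hf.pos p.1).ne'
  have hgFp : gF p.2 = ⟪u₂, v₂⟫_ℝ := by simp only [gF, coordField_self]
  simp only [add_apply, smul_apply, smul_eq_mul]
  rw [e1, e2, e3, hf.mvfderiv_log, hgFp]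
  change metricDeriv IB _ u₁ v₁ + (f p.1 * f p.1 * metricDeriv IF _ u₂ v₂ + _) = _
  field_simp
  ring

end IsWarpedProduct
end WarpedProduct

section PointwiseSemiSlant

variable {T : Type*} [NormedAddCommGroup T] [InnerProductSpace ℝ T] [FiniteDimensional ℝ T]
  {V : Type*} [NormedAddCommGroup V] [InnerProductSpace ℝ V] [FiniteDimensional ℝ V]

theorem sum_inner_sq_of_mem {D : Submodule ℝ T} {ι : Type*} [Fintype ι]
    (b : OrthonormalBasis ι ℝ D) {x : T} (hx : x ∈ D) : ∑ j, ⟪x, b j⟫_ℝ ^ 2 = ⟪x, x⟫_ℝ := by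
  have e := b.sum_inner_mul_inner ⟨x, hx⟩ ⟨x, hx⟩
  refine Eq.trans (Finset.sum_congr rfl fun j _ => ?_) e
  rw [pow_two, real_inner_comm (⟨x, hx⟩ : D) (b j)]
  rfl

theorem sum_inner_sq_add_sum_inner_sq {D₁ D₂ : Submodule ℝ T} (h : D₂ = D₁ᗮ) {ι₁ ι₂ : Type*}
    [Fintype ι₁] [Fintype ι₂] (b₁ : OrthonormalBasis ι₁ ℝ D₁) (b₂ : OrthonormalBasis ι₂ ℝ D₂)
    (x : T) :
    ∑ j, ⟪x, b₁ j⟫_ℝ ^ 2 + ∑ k, ⟪x, b₂ k⟫_ℝ ^ 2 = ⟪x, x⟫_ℝ := by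
  subst h
  obtain ⟨y, hy, z, hz, rfl⟩ := D₁.exists_add_mem_mem_orthogonal x
  have h1 : ∀ j, ⟪y + z, b₁ j⟫_ℝ = ⟪y, b₁ j⟫_ℝ := fun j => by
    rw [inner_add_left, Submodule.inner_left_of_mem_orthogonal (b₁ j).2 hz, add_zero]
  have h2 : ∀ k, ⟪y + z, b₂ k⟫_ℝ = ⟪z, b₂ k⟫_ℝ := fun k => by
    rw [inner_add_left, Submodule.inner_right_of_mem_orthogonal hy (b₂ k).2, zero_add]
  simp only [h1, h2]
  rw [sum_inner_sq_of_mem b₁ hy, sum_inner_sq_of_mem b₂ hz, real_inner_add_add_self,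
    Submodule.inner_right_of_mem_orthogonal hy hz]
  ring

theorem sum_inner_self_eq {ι : Type*} [Fintype ι] (e : OrthonormalBasis ι ℝ T)
    {D₁ D₂ : Submodule ℝ T} (h : D₂ = D₁ᗮ) {ι₁ ι₂ : Type*} [Fintype ι₁] [Fintype ι₂]
    (b₁ : OrthonormalBasis ι₁ ℝ D₁) (b₂ : OrthonormalBasis ι₂ ℝ D₂) (f : T →ₗ[ℝ] V) :
    ∑ i, ⟪f (e i), f (e i)⟫_ℝ =
      ∑ j, ⟪f (b₁ j), f (b₁ j)⟫_ℝ + ∑ k, ⟪f (b₂ k), f (b₂ k)⟫_ℝ := by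
  let c := stdOrthonormalBasis ℝ V
  have key : ∀ u : T, ⟪f u, f u⟫_ℝ = ∑ k, ⟪f.adjoint (c k), u⟫_ℝ ^ 2 := fun u => by
    rw [← c.sum_inner_mul_inner (f u) (f u)]
    refine Finset.sum_congr rfl fun k _ => ?_
    rw [LinearMap.adjoint_inner_left, real_inner_comm, pow_two]
  simp only [key]
  rw [Finset.sum_comm, Finset.sum_comm (s := (Finset.univ : Finset ι₁)),
    Finset.sum_comm (s := (Finset.univ : Finset ι₂)), ← Finset.sum_add_distrib]
  refine Finset.sum_congr rfl fun k _ => ?_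
  rw [sum_inner_sq_add_sum_inner_sq h b₁ b₂, ← e.sum_inner_mul_inner]
  refine Finset.sum_congr rfl fun i _ => ?_
  rw [real_inner_comm _ (e i), pow_two]

/-- The first order data, at one point, of a proper pointwise semi-slant submanifold tangent to
the structure vector field. -/
structure SemiSlantPoint (φ : V →ₗ[ℝ] V) (ξ : V) (η : V →ₗ[ℝ] ℝ) (L : T →ₗ[ℝ] V)
    (D₁ D₂ : Submodule ℝ T) (θ : ℝ) : Prop where
  contact : IsAlmostContact φ ξ η
  inner_L : ∀ u v, ⟪L u, L v⟫_ℝ = ⟪u, v⟫_ℝ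
  orthogonal : D₂ = D₁ᗮ
  invariant : ∀ u ∈ D₁, φ (L u) ∈ D₁.map L
  slant : ∀ v ∈ D₂, v ≠ 0 → φ (L v) ≠ 0 ∧
    InnerProductGeometry.angle (φ (L v)) ((D₂.map L).starProjection (φ (L v))) = θ
  proper : θ ∈ Set.Ioo 0 (Real.pi / 2)
  ξ_mem : ξ ∈ LinearMap.range L

namespace SemiSlantPoint

variable {φ : V →ₗ[ℝ] V} {ξ : V} {η : V →ₗ[ℝ] ℝ} {L : T →ₗ[ℝ] V} {D₁ D₂ : Submodule ℝ T} {θ : ℝ}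
  (h : SemiSlantPoint φ ξ η L D₁ D₂ θ)
include h

theorem inner_eq_zero {X Z : T} (hX : X ∈ D₁) (hZ : Z ∈ D₂) : ⟪X, Z⟫_ℝ = 0 := by
  rw [h.orthogonal] at hZ
  exact Submodule.inner_right_of_mem_orthogonal hX hZ

theorem exists_add (u : T) : ∃ X ∈ D₁, ∃ Z ∈ D₂, u = X + Z := by
  rw [h.orthogonal]
  exact D₁.exists_add_mem_mem_orthogonal u

theorem sin_pos : 0 < Real.sin θ :=
  Real.sin_pos_of_mem_Ioo ⟨h.proper.1, by linarith [h.proper.2, Real.pi_pos]⟩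

theorem inner_φ_base_fiber {X Z : T} (hX : X ∈ D₁) (hZ : Z ∈ D₂) : ⟪φ (L X), L Z⟫_ℝ = 0 := by
  obtain ⟨Y, hY, e⟩ := h.invariant X hX
  rw [← e, h.inner_L, h.inner_eq_zero hY hZ]

theorem inner_φ_fiber_base {X Z : T} (hX : X ∈ D₁) (hZ : Z ∈ D₂) : ⟪φ (L Z), L X⟫_ℝ = 0 := by
  rw [h.contact.inner_φ_left, real_inner_comm, h.inner_φ_base_fiber hX hZ, neg_zero]

theorem ξ_mem_base : ξ ∈ D₁.map L := by
  obtain ⟨w, hw⟩ := h.ξ_mem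
  obtain ⟨X, hX, Z, hZ, rfl⟩ := h.exists_add w
  by_cases hZ0 : Z = 0
  · exact ⟨X, hX, by rw [← hw, hZ0, add_zero]⟩
  exfalso
  obtain ⟨-, ha⟩ := h.slant Z hZ hZ0
  have h0 : φ (L Z) = -φ (L X) := by
    have := h.contact.φ_ξ
    rw [← hw, map_add, map_add] at this
    exact eq_neg_of_add_eq_zero_right this
  have hproj : (D₂.map L).starProjection (φ (L Z)) = 0 := by
    rw [Submodule.starProjection_apply_eq_zero_iff, Submodule.mem_orthogonal]
    rintro _ ⟨W, hW, rfl⟩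
    rw [h0, inner_neg_right, real_inner_comm, h.inner_φ_base_fiber hX hW, neg_zero]
  rw [hproj, InnerProductGeometry.angle_zero_right] at ha
  linarith [h.proper.2]

theorem η_fiber {Z : T} (hZ : Z ∈ D₂) : η (L Z) = 0 := by
  obtain ⟨X, hX, e⟩ := h.ξ_mem_base
  rw [h.contact.η_apply, ← e, h.inner_L, h.inner_eq_zero hX hZ]

theorem inner_ξ_fiber {Z : T} (hZ : Z ∈ D₂) : ⟪ξ, L Z⟫_ℝ = 0 := by
  have := h.contact.η_apply (L Z)
  rw [h.η_fiber hZ] at this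
  exact this.symm

end SemiSlantPoint

/-- The tangential component of `φ`. -/
noncomputable def tanPart (φ : V →ₗ[ℝ] V) (L : T →ₗ[ℝ] V) : T →ₗ[ℝ] T := L.adjoint ∘ₗ φ ∘ₗ L

/-- The normal component of `φ`. -/
noncomputable def norPart (φ : V →ₗ[ℝ] V) (L : T →ₗ[ℝ] V) : T →ₗ[ℝ] V :=
  φ ∘ₗ L - L ∘ₗ tanPart φ L

theorem φ_eq_tanPart_add_norPart (φ : V →ₗ[ℝ] V) (L : T →ₗ[ℝ] V) (u : T) :
    φ (L u) = L (tanPart φ L u) + norPart φ L u := by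
  simp [norPart]

theorem inner_tanPart (φ : V →ₗ[ℝ] V) (L : T →ₗ[ℝ] V) (u v : T) :
    ⟪tanPart φ L u, v⟫_ℝ = ⟪φ (L u), L v⟫_ℝ := by
  rw [tanPart, LinearMap.comp_apply, LinearMap.adjoint_inner_left, LinearMap.comp_apply]

namespace SemiSlantPoint

variable {φ : V →ₗ[ℝ] V} {ξ : V} {η : V →ₗ[ℝ] ℝ} {L : T →ₗ[ℝ] V} {D₁ D₂ : Submodule ℝ T} {θ : ℝ}
  (h : SemiSlantPoint φ ξ η L D₁ D₂ θ)
include h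

theorem inner_norPart_L (u v : T) : ⟪norPart φ L u, L v⟫_ℝ = 0 := by
  have := φ_eq_tanPart_add_norPart φ L u
  have h1 : norPart φ L u = φ (L u) - L (tanPart φ L u) := by rw [this]; abel
  rw [h1, inner_sub_left, h.inner_L, inner_tanPart, sub_self]

theorem norPart_mem (u : T) : norPart φ L u ∈ (LinearMap.range L)ᗮ := by
  rw [Submodule.mem_orthogonal']
  rintro _ ⟨v, rfl⟩
  exact h.inner_norPart_L u v

theorem tanPart_mem {Z : T} (hZ : Z ∈ D₂) : tanPart φ L Z ∈ D₂ := by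
  rw [h.orthogonal, Submodule.mem_orthogonal']
  intro X hX
  rw [inner_tanPart, h.inner_φ_fiber_base hX hZ]

theorem tanPart_skew (u v : T) : ⟪tanPart φ L u, v⟫_ℝ = -⟪u, tanPart φ L v⟫_ℝ := by
  rw [inner_tanPart, h.contact.inner_φ_left, real_inner_comm (tanPart φ L v), inner_tanPart,
    real_inner_comm (φ (L v))]

theorem inner_φ_φ_fiber {Z W : T} (hZ : Z ∈ D₂) : ⟪φ (L Z), φ (L W)⟫_ℝ = ⟪Z, W⟫_ℝ := by
  rw [h.contact.inner_φ_φ, h.η_fiber hZ, h.inner_L]; ring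

theorem starProjection_φ {Z : T} (hZ : Z ∈ D₂) :
    (D₂.map L).starProjection (φ (L Z)) = L (tanPart φ L Z) := by
  refine Submodule.eq_starProjection_of_mem_of_inner_eq_zero
    (Submodule.mem_map_of_mem (h.tanPart_mem hZ)) ?_
  rintro _ ⟨W, -, rfl⟩
  rw [inner_sub_left, h.inner_L, inner_tanPart, sub_self]

theorem inner_tanPart_self {Z : T} (hZ : Z ∈ D₂) :
    ⟪tanPart φ L Z, tanPart φ L Z⟫_ℝ = Real.cos θ ^ 2 * ⟪Z, Z⟫_ℝ := by
  by_cases hZ0 : Z = 0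
  · simp [hZ0]
  obtain ⟨-, ha⟩ := h.slant Z hZ hZ0
  rw [h.starProjection_φ hZ] at ha
  have h1 := InnerProductGeometry.cos_angle_mul_norm_mul_norm (φ (L Z)) (L (tanPart φ L Z))
  rw [ha, ← inner_tanPart] at h1
  have h2 : ‖φ (L Z)‖ = ‖Z‖ := by
    rw [norm_eq_sqrt_real_inner, norm_eq_sqrt_real_inner, h.inner_φ_φ_fiber hZ]
  have h3 : ‖L (tanPart φ L Z)‖ = ‖tanPart φ L Z‖ := by
    rw [norm_eq_sqrt_real_inner, norm_eq_sqrt_real_inner, h.inner_L]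
  have h4 : ‖tanPart φ L Z‖ ≠ 0 := fun h0 => by
    rw [norm_eq_zero] at h0
    rw [h0, map_zero, InnerProductGeometry.angle_zero_right] at ha
    linarith [h.proper.2]
  rw [h2, h3, real_inner_self_eq_norm_sq] at h1
  have h5 : ‖tanPart φ L Z‖ = Real.cos θ * ‖Z‖ := by
    refine mul_right_cancel₀ h4 ?_
    linarith
  rw [real_inner_self_eq_norm_sq, real_inner_self_eq_norm_sq, h5]
  ring

theorem inner_tanPart_tanPart {Z W : T} (hZ : Z ∈ D₂) (hW : W ∈ D₂) :
    ⟪tanPart φ L Z, tanPart φ L W⟫_ℝ = Real.cos θ ^ 2 * ⟪Z, W⟫_ℝ := by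
  have h1 := h.inner_tanPart_self (D₂.add_mem hZ hW)
  rw [map_add, real_inner_add_add_self, real_inner_add_add_self] at h1
  linarith [h.inner_tanPart_self hZ, h.inner_tanPart_self hW]

theorem inner_norPart_norPart {Z W : T} (hZ : Z ∈ D₂) (hW : W ∈ D₂) :
    ⟪norPart φ L Z, norPart φ L W⟫_ℝ = Real.sin θ ^ 2 * ⟪Z, W⟫_ℝ := by
  have h1 := h.inner_φ_φ_fiber (W := W) hZ
  rw [φ_eq_tanPart_add_norPart φ L Z, φ_eq_tanPart_add_norPart φ L W, inner_add_left,
    inner_add_right, inner_add_right, h.inner_L, h.inner_norPart_L,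
    real_inner_comm (norPart φ L W) (L (tanPart φ L Z)), h.inner_norPart_L, h.inner_tanPart_tanPart hZ hW] at h1
  have := Real.sin_sq_add_cos_sq θ
  linear_combination h1 - ⟪Z, W⟫_ℝ * this

theorem norPart_eq_zero {Z : T} (hZ : Z ∈ D₂) (h0 : norPart φ L Z = 0) : Z = 0 := by
  have h1 := h.inner_norPart_norPart hZ hZ
  rw [h0, inner_zero_left] at h1
  have := h.sin_pos
  rcases mul_eq_zero.1 h1.symm with h2 | h2
  · exact absurd h2 (by positivity)
  · exact inner_self_eq_zero.1 h2

/-- If the codimension equals the rank of the slant distribution, the normal space is the normal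
part of `φ` of that distribution. -/
theorem exists_norPart_eq
    (hdim : Module.finrank ℝ V = Module.finrank ℝ T + Module.finrank ℝ D₂) {x : V}
    (hx : x ∈ (LinearMap.range L)ᗮ) : ∃ Z ∈ D₂, norPart φ L Z = x := by
  have hL : Function.Injective L := (injective_iff_map_eq_zero L).2 fun v hv => by
    have := h.inner_L v v
    rw [hv, inner_zero_left] at this
    exact inner_self_eq_zero.1 this.symm
  have h1 := (LinearMap.range L).finrank_add_finrank_orthogonal
  rw [LinearMap.finrank_range_of_inj hL] at h1
  have h2 : Function.Injective ((norPart φ L).domRestrict D₂) :=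
    (injective_iff_map_eq_zero _).2 fun v hv =>
      Subtype.ext (h.norPart_eq_zero v.2 hv)
  have h3 := LinearMap.finrank_range_of_inj h2
  rw [LinearMap.range_domRestrict] at h3
  have h4 : D₂.map (norPart φ L) = (LinearMap.range L)ᗮ := by
    refine Submodule.eq_of_le_of_finrank_eq ?_ (by omega)
    rintro _ ⟨Z, -, rfl⟩
    exact h.norPart_mem Z
  rw [← h4] at hx
  exact hx

end SemiSlantPoint
end PointwiseSemiSlant

section PointwiseInequality

variable {T : Type*} [NormedAddCommGroup T] [InnerProductSpace ℝ T] [FiniteDimensional ℝ T]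
  {V : Type*} [NormedAddCommGroup V] [InnerProductSpace ℝ V] [FiniteDimensional ℝ V]

theorem sum_sum_inner_self_eq {ι : Type*} [Fintype ι] (e : OrthonormalBasis ι ℝ T)
    {D₁ D₂ : Submodule ℝ T} (h : D₂ = D₁ᗮ) {ι₁ ι₂ : Type*} [Fintype ι₁] [Fintype ι₂]
    (b₁ : OrthonormalBasis ι₁ ℝ D₁) (b₂ : OrthonormalBasis ι₂ ℝ D₂) (B : T →ₗ[ℝ] T →ₗ[ℝ] V)
    (hB : ∀ u v, B u v = B v u) :
    ∑ j, ∑ k, ⟪B (e j) (e k), B (e j) (e k)⟫_ℝ =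
      ∑ j, ∑ k, ⟪B (b₁ j) (b₁ k), B (b₁ j) (b₁ k)⟫_ℝ
      + 2 * ∑ k, ∑ j, ⟪B (b₁ j) (b₂ k), B (b₁ j) (b₂ k)⟫_ℝ
      + ∑ j, ∑ k, ⟪B (b₂ j) (b₂ k), B (b₂ j) (b₂ k)⟫_ℝ := by
  have h1 : ∀ u, ∑ j, ⟪B (e j) u, B (e j) u⟫_ℝ =
      ∑ j, ⟪B (b₁ j) u, B (b₁ j) u⟫_ℝ + ∑ j, ⟪B (b₂ j) u, B (b₂ j) u⟫_ℝ := fun u =>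
    sum_inner_self_eq e h b₁ b₂ (B.flip u)
  have h2 : ∀ u, ∑ k, ⟪B u (e k), B u (e k)⟫_ℝ =
      ∑ k, ⟪B u (b₁ k), B u (b₁ k)⟫_ℝ + ∑ k, ⟪B u (b₂ k), B u (b₂ k)⟫_ℝ := fun u =>
    sum_inner_self_eq e h b₁ b₂ (B u)
  simp only [h2]
  rw [Finset.sum_add_distrib, Finset.sum_comm, Finset.sum_comm (t := (Finset.univ : Finset ι₂))]
  simp only [h1]
  rw [Finset.sum_add_distrib, Finset.sum_add_distrib,
    Finset.sum_comm (s := (Finset.univ : Finset ι₁)) (t := (Finset.univ : Finset ι₁)),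
    Finset.sum_comm (s := (Finset.univ : Finset ι₂)) (t := (Finset.univ : Finset ι₂)),
    Finset.sum_comm (s := (Finset.univ : Finset ι₁)) (t := (Finset.univ : Finset ι₂))]
  simp only [hB (b₂ _) (b₁ _)]
  ring

/-- The second order data, at one point, of a proper pointwise semi-slant warped product in a
trans-Sasakian manifold: `A` is the ambient derivative of coordinate fields and `l` the differential
of the logarithm of the warping function. -/
structure SemiSlantWarpedPoint (φ : V →ₗ[ℝ] V) (ξ : V) (η : V →ₗ[ℝ] ℝ) (L : T →ₗ[ℝ] V)
    (D₁ D₂ : Submodule ℝ T) (θ : ℝ) (A : T →ₗ[ℝ] T →ₗ[ℝ] V) (l : T →ₗ[ℝ] ℝ) (κ μ : ℝ) : Prop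
    extends SemiSlantPoint φ ξ η L D₁ D₂ θ where
  symm : ∀ u v, A u v = A v u
  base_base_fiber : ∀ X ∈ D₁, ∀ Y ∈ D₁, ∀ Z ∈ D₂, ⟪A X Y, L Z⟫_ℝ = 0
  base_fiber_base : ∀ X ∈ D₁, ∀ Z ∈ D₂, ∀ Y ∈ D₁, ⟪A X Z, L Y⟫_ℝ = 0
  base_fiber_fiber : ∀ X ∈ D₁, ∀ Z ∈ D₂, ∀ W ∈ D₂, ⟪A X Z, L W⟫_ℝ = l X * ⟪Z, W⟫_ℝ
  fiber_fiber_base : ∀ Z ∈ D₂, ∀ W ∈ D₂, ∀ X ∈ D₁, ⟪A Z W, L X⟫_ℝ = -(l X * ⟪Z, W⟫_ℝ)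
  log_fiber : ∀ Z ∈ D₂, l Z = 0
  deriv_φ : ∀ u, ∀ X ∈ D₁, ∀ Z ∈ D₂,
    ⟪κ • (⟪L u, L X⟫_ℝ • ξ - η (L X) • L u) + μ • (⟪φ (L u), L X⟫_ℝ • ξ - η (L X) • φ (L u)),
      L Z⟫_ℝ + ⟪φ (A u X), L Z⟫_ℝ + ⟪φ (L X), A u Z⟫_ℝ = 0
  deriv_ξ : ∀ u, ∀ W ∈ D₂,
    ⟪-κ • φ (L u) + μ • (L u - η (L u) • ξ), L W⟫_ℝ + ⟪ξ, A u W⟫_ℝ = 0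

namespace SemiSlantWarpedPoint

variable {φ : V →ₗ[ℝ] V} {ξ : V} {η : V →ₗ[ℝ] ℝ} {L : T →ₗ[ℝ] V} {D₁ D₂ : Submodule ℝ T} {θ : ℝ}
  {A : T →ₗ[ℝ] T →ₗ[ℝ] V} {l : T →ₗ[ℝ] ℝ} {κ μ : ℝ}
  (h : SemiSlantWarpedPoint φ ξ η L D₁ D₂ θ A l κ μ)
include h

theorem deriv_φ_eq (u : T) {X Z : T} (hX : X ∈ D₁) (hZ : Z ∈ D₂) :
    ⟪A u X, norPart φ L Z⟫_ℝ = ⟪φ (L X), A u Z⟫_ℝ - ⟪A u X, L (tanPart φ L Z)⟫_ℝ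
      - κ * η (L X) * ⟪u, Z⟫_ℝ - μ * η (L X) * ⟪tanPart φ L u, Z⟫_ℝ := by
  have e := h.deriv_φ u X hX Z hZ
  rw [h.contact.inner_φ_left (A u X), φ_eq_tanPart_add_norPart φ L Z,
    inner_add_right (A u X)] at e
  simp only [inner_add_left, inner_sub_left, real_inner_smul_left, h.inner_ξ_fiber hZ, h.inner_L,
    ← inner_tanPart] at e
  linear_combination -e

theorem inner_base_base_norPart {X Y Z : T} (hX : X ∈ D₁) (hY : Y ∈ D₁) (hZ : Z ∈ D₂) :
    ⟪A X Y, norPart φ L Z⟫_ℝ = 0 := by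
  obtain ⟨Y', hY', e⟩ := h.invariant Y hY
  rw [h.deriv_φ_eq X hY hZ, ← e, real_inner_comm, h.base_fiber_base X hX Z hZ Y' hY',
    h.base_base_fiber X hX Y hY _ (h.tanPart_mem hZ), h.inner_eq_zero hX hZ, inner_tanPart,
    h.inner_φ_base_fiber hX hZ]
  ring

theorem mul_inner_tanPart {w Z W : T} (hw : w ∈ D₁) (hξ : L w = ξ) (hZ : Z ∈ D₂) (hW : W ∈ D₂) :
    κ * ⟪tanPart φ L Z, W⟫_ℝ = (μ - l w) * ⟪Z, W⟫_ℝ := by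
  have e := h.deriv_ξ Z W hW
  rw [h.η_fiber hZ, zero_smul, sub_zero, inner_add_left, real_inner_smul_left,
    real_inner_smul_left, h.inner_L, ← inner_tanPart, ← hξ, real_inner_comm (A Z W),
    h.fiber_fiber_base Z hZ W hW w hw] at e
  linear_combination -e

theorem tanPart_inner_self (Z : T) : ⟪tanPart φ L Z, Z⟫_ℝ = 0 := by
  have := h.tanPart_skew Z Z
  rw [real_inner_comm (tanPart φ L Z) Z] at this
  linarith

theorem log_ξ_mul {w Z : T} (hw : w ∈ D₁) (hξ : L w = ξ) (hZ : Z ∈ D₂) :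
    l w * ⟪Z, Z⟫_ℝ = μ * ⟪Z, Z⟫_ℝ := by
  have e := h.mul_inner_tanPart hw hξ hZ hZ
  rw [h.tanPart_inner_self] at e
  linear_combination e

theorem mul_inner_eq_mul_sin_sq {Z W : T} (hZ : Z ∈ D₂) (hW : W ∈ D₂) :
    κ * ⟪Z, W⟫_ℝ = κ * Real.sin θ ^ 2 * ⟪Z, W⟫_ℝ := by
  obtain ⟨w, hw, hξ⟩ := h.ξ_mem_base
  have e1 := h.mul_inner_tanPart hw hξ hZ (h.tanPart_mem hW)
  have e2 := h.mul_inner_tanPart hw hξ hZ hZ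
  rw [h.tanPart_inner_self] at e2
  have e3 : (μ - l w) * ⟪Z, tanPart φ L W⟫_ℝ = 0 := by
    rcases mul_eq_zero.1 (e2.symm.trans (mul_zero κ)) with h0 | h0
    · rw [h0, zero_mul]
    · rw [inner_self_eq_zero.1 h0, inner_zero_left, mul_zero]
  rw [h.inner_tanPart_tanPart hZ hW, e3] at e1
  have := Real.sin_sq_add_cos_sq θ
  linear_combination e1 - κ * ⟪Z, W⟫_ℝ * this

theorem inner_base_fiber_norPart {X X' Z W : T} (hX : X ∈ D₁) (hX' : X' ∈ D₁)
    (e : L X' = φ (L X)) (hZ : Z ∈ D₂) (hW : W ∈ D₂) :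
    ⟪A X Z, norPart φ L W⟫_ℝ = -(l X' + κ * Real.sin θ ^ 2 * η (L X)) * ⟪Z, W⟫_ℝ
      - (μ * η (L X) - l X) * ⟪tanPart φ L Z, W⟫_ℝ := by
  have h1 := h.deriv_φ_eq Z hX hW
  rw [h.symm Z X, ← e, real_inner_comm (A Z W), h.fiber_fiber_base Z hZ W hW X' hX',
    h.base_fiber_fiber X hX Z hZ _ (h.tanPart_mem hW)] at h1
  have h2 := h.tanPart_skew Z W
  have h3 := h.mul_inner_eq_mul_sin_sq hZ hW
  linear_combination h1 - l X * h2 - η (L X) * h3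

theorem starProjection_base_base {X Y : T} (hdim : Module.finrank ℝ V =
    Module.finrank ℝ T + Module.finrank ℝ D₂) (hX : X ∈ D₁) (hY : Y ∈ D₁) :
    (LinearMap.range L)ᗮ.starProjection (A X Y) = 0 := by
  rw [Submodule.starProjection_apply_eq_zero_iff, Submodule.mem_orthogonal']
  intro x hx
  obtain ⟨Z, hZ, rfl⟩ := h.exists_norPart_eq hdim hx
  exact h.inner_base_base_norPart hX hY hZ

theorem sin_sq_mul_inner_starProjection {X X' Z : T} (hdim : Module.finrank ℝ V =
    Module.finrank ℝ T + Module.finrank ℝ D₂) (hX : X ∈ D₁) (hX' : X' ∈ D₁)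
    (e : L X' = φ (L X)) (hZ : Z ∈ D₂) :
    Real.sin θ ^ 2 * ⟪(LinearMap.range L)ᗮ.starProjection (A X Z),
      (LinearMap.range L)ᗮ.starProjection (A X Z)⟫_ℝ =
    ((l X' + κ * Real.sin θ ^ 2 * η (L X)) ^ 2
      + Real.cos θ ^ 2 * (μ * η (L X) - l X) ^ 2) * ⟪Z, Z⟫_ℝ := by
  obtain ⟨Y, hY, hYe⟩ := h.exists_norPart_eq hdim
    (Submodule.starProjection_apply_mem (LinearMap.range L)ᗮ (A X Z))
  set a := l X' + κ * Real.sin θ ^ 2 * η (L X) with ha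
  set b := μ * η (L X) - l X with hb
  have h1 : ∀ W ∈ D₂, Real.sin θ ^ 2 * ⟪Y, W⟫_ℝ = ⟪-(a • Z) - b • tanPart φ L Z, W⟫_ℝ := by
    intro W hW
    rw [← h.inner_norPart_norPart hY hW, hYe, Submodule.inner_starProjection_left_eq_right,
      Submodule.starProjection_eq_self_iff.2 (h.norPart_mem W),
      h.inner_base_fiber_norPart hX hX' e hZ hW, inner_sub_left, inner_neg_left,
      real_inner_smul_left, real_inner_smul_left, neg_mul]
  have hU : -(a • Z) - b • tanPart φ L Z ∈ D₂ :=
    D₂.sub_mem (D₂.neg_mem (D₂.smul_mem _ hZ)) (D₂.smul_mem _ (h.tanPart_mem hZ))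
  have h2 := h1 _ hY
  have h3 := h1 _ hU
  rw [← hYe, h.inner_norPart_norPart hY hY]
  set U := -(a • Z) - b • tanPart φ L Z with hUd
  have h4 : ⟪U, U⟫_ℝ = (a ^ 2 + Real.cos θ ^ 2 * b ^ 2) * ⟪Z, Z⟫_ℝ := by
    rw [hUd, real_inner_sub_sub_self]
    simp only [inner_neg_left, inner_neg_right, real_inner_smul_left, real_inner_smul_right,
      h.inner_tanPart_tanPart hZ hZ, real_inner_comm (tanPart φ L Z) Z, h.tanPart_inner_self]
    ring
  rw [← h4, ← h3]
  linear_combination Real.sin θ ^ 2 * h2 + Real.sin θ ^ 2 * real_inner_comm Y U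

theorem sum_inner_starProjection_base_fiber {ι₁ : Type*} [Fintype ι₁]
    (b₁ : OrthonormalBasis ι₁ ℝ D₁) (hdim : Module.finrank ℝ V =
    Module.finrank ℝ T + Module.finrank ℝ D₂) {G Z : T} (hG : ∀ v, ⟪G, v⟫_ℝ = l v)
    (hZ : Z ∈ D₂) (hZ1 : ⟪Z, Z⟫_ℝ = 1) :
    ∑ j, ⟪(LinearMap.range L)ᗮ.starProjection (A (b₁ j) Z),
      (LinearMap.range L)ᗮ.starProjection (A (b₁ j) Z)⟫_ℝ =
    (1 / Real.sin θ ^ 2 + Real.cot θ ^ 2) * ‖φ (L G)‖ ^ 2 + κ ^ 2 * Real.sin θ ^ 2 := by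
  obtain ⟨w, hw, hξ⟩ := h.ξ_mem_base
  have hs := h.sin_pos
  have hlw : l w = μ := by
    have := h.log_ξ_mul hw hξ hZ
    rwa [hZ1, mul_one, mul_one] at this
  have hG1 : G ∈ D₁ := by
    have : G ∈ D₁ᗮᗮ := by
      rw [← h.orthogonal, Submodule.mem_orthogonal']
      intro W hW
      rw [hG, h.log_fiber W hW]
    rwa [Submodule.orthogonal_orthogonal] at this
  obtain ⟨G', hG', eG⟩ := h.invariant G hG1
  have hww : ⟪w, w⟫_ℝ = 1 := by rw [← h.inner_L, hξ, h.contact.inner_ξ_ξ]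
  have hGw : ⟪G', w⟫_ℝ = 0 := by
    rw [← h.inner_L, hξ, eG, real_inner_comm, h.contact.inner_ξ_φ]
  have hη : ∀ v, η (L v) = ⟪w, v⟫_ℝ := fun v => by
    rw [h.contact.η_apply, ← hξ, h.inner_L, real_inner_comm]
  have hG'G' : ⟪G', G'⟫_ℝ = ⟪G, G⟫_ℝ - μ ^ 2 := by
    rw [← h.inner_L, eG, h.contact.inner_φ_φ, h.inner_L, hη, real_inner_comm G w, hG w, hlw, pow_two]
  have hn : ‖φ (L G)‖ ^ 2 = ⟪G', G'⟫_ℝ := by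
    rw [← real_inner_self_eq_norm_sq, ← eG, h.inner_L]
  have key : ∀ j, Real.sin θ ^ 2 * ⟪(LinearMap.range L)ᗮ.starProjection (A (b₁ j) Z),
      (LinearMap.range L)ᗮ.starProjection (A (b₁ j) Z)⟫_ℝ =
      ⟪G' - (κ * Real.sin θ ^ 2) • w, b₁ j⟫_ℝ ^ 2
        + Real.cos θ ^ 2 * ⟪μ • w - G, b₁ j⟫_ℝ ^ 2 := fun j => by
    obtain ⟨X', hX', eX⟩ := h.invariant (b₁ j) (b₁ j).2
    have h1 : l X' = -⟪G', b₁ j⟫_ℝ := by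
      rw [← hG, ← h.inner_L, eX, real_inner_comm, h.contact.inner_φ_left, ← eG, h.inner_L,
        real_inner_comm]
    rw [h.sin_sq_mul_inner_starProjection hdim (b₁ j).2 hX' eX hZ, hZ1, h1, hη, ← hG,
      inner_sub_left, inner_sub_left, real_inner_smul_left, real_inner_smul_left]
    ring
  have hsum := Finset.sum_congr (s₁ := Finset.univ) rfl fun j _ => key j
  rw [← Finset.mul_sum, Finset.sum_add_distrib, ← Finset.mul_sum,
    sum_inner_sq_of_mem b₁ (D₁.sub_mem hG' (D₁.smul_mem _ hw)),
    sum_inner_sq_of_mem b₁ (D₁.sub_mem (D₁.smul_mem _ hw) hG1), real_inner_sub_sub_self,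
    real_inner_sub_sub_self] at hsum
  simp only [real_inner_smul_left, real_inner_smul_right, hGw, hww, real_inner_comm G w, hG w,
    hlw, mul_zero, sub_zero] at hsum
  refine mul_left_cancel₀ (pow_pos hs 2).ne' (hsum.trans ?_)
  rw [Real.cot_eq_cos_div_sin, hn]
  field_simp
  rw [hG'G']
  ring

/-- The sharp pointwise inequality between the second fundamental form and the gradient of the
logarithm of the warping function. -/
theorem le_sum_inner_starProjection {ι : Type*} [Fintype ι] (e : OrthonormalBasis ι ℝ T)
    (hdim : Module.finrank ℝ V = Module.finrank ℝ T + Module.finrank ℝ D₂) {G : T}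
    (hG : ∀ v, ⟪G, v⟫_ℝ = l v) {C S : ℝ}
    (hC : C = 2 * Module.finrank ℝ D₂ * ((1 / Real.sin θ ^ 2 + Real.cot θ ^ 2) * ‖φ (L G)‖ ^ 2
      + κ ^ 2 * Real.sin θ ^ 2))
    (hS : S = ∑ j, ∑ k, ⟪(LinearMap.range L)ᗮ.starProjection (A (e j) (e k)),
      (LinearMap.range L)ᗮ.starProjection (A (e j) (e k))⟫_ℝ) :
    C ≤ S ∧ (S = C ↔ ∀ Z ∈ D₂, ∀ W ∈ D₂, ∀ x ∈ (LinearMap.range L)ᗮ,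
      ⟪(LinearMap.range L)ᗮ.starProjection (A Z W), x⟫_ℝ = 0) := by
  let B : T →ₗ[ℝ] T →ₗ[ℝ] V := A.compr₂ (LinearMap.range L)ᗮ.starProjection.toLinearMap
  have hB : ∀ u v, B u v = (LinearMap.range L)ᗮ.starProjection (A u v) := fun u v => rfl
  let b₁ := stdOrthonormalBasis ℝ D₁
  let b₂ := stdOrthonormalBasis ℝ D₂
  have h1 := sum_sum_inner_self_eq e h.orthogonal b₁ b₂ B fun u v => by rw [hB, hB, h.symm]
  have h2 : ∀ k, ∑ j, ⟪B (b₁ j) (b₂ k), B (b₁ j) (b₂ k)⟫_ℝ = _ := fun k =>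
    h.sum_inner_starProjection_base_fiber b₁ hdim hG (b₂ k).2
      (by rw [real_inner_self_eq_norm_sq, ← Submodule.coe_norm, b₂.norm_eq_one, one_pow])
  have h3 : ∀ j k, B (b₁ j) (b₁ k) = 0 := fun j k =>
    h.starProjection_base_base hdim (b₁ j).2 (b₁ k).2
  simp only [h2, h3, inner_zero_left, Finset.sum_const_zero, Finset.sum_const, Finset.card_univ,
    Fintype.card_fin, nsmul_eq_mul, zero_add, ← mul_assoc] at h1
  have h4 : S = C + ∑ j, ∑ k, ⟪B (b₂ j) (b₂ k), B (b₂ j) (b₂ k)⟫_ℝ := by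
    rw [hS, hC]
    refine h1.trans ?_
    ring
  have h5 : ∀ j, 0 ≤ ∑ k, ⟪B (b₂ j) (b₂ k), B (b₂ j) (b₂ k)⟫_ℝ := fun j =>
    Finset.sum_nonneg fun k _ => real_inner_self_nonneg
  have h6 : 0 ≤ ∑ j, ∑ k, ⟪B (b₂ j) (b₂ k), B (b₂ j) (b₂ k)⟫_ℝ :=
    Finset.sum_nonneg fun j _ => h5 j
  refine ⟨by linarith, ⟨fun hSC => ?_, fun h0 => ?_⟩⟩
  · have h7 : ∑ j, ∑ k, ⟪B (b₂ j) (b₂ k), B (b₂ j) (b₂ k)⟫_ℝ = 0 := by linarith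
    have h8 : ∀ j k, B (b₂ j) (b₂ k) = 0 := fun j k => by
      have h9 := (Finset.sum_eq_zero_iff_of_nonneg fun j _ => h5 j).1 h7 j (Finset.mem_univ j)
      exact inner_self_eq_zero.1 ((Finset.sum_eq_zero_iff_of_nonneg
        fun k _ => real_inner_self_nonneg).1 h9 k (Finset.mem_univ k))
    have h9 : B.domRestrict₁₂ D₂ D₂ = 0 :=
      LinearMap.ext_basis b₂.toBasis b₂.toBasis fun j k => by
        rw [b₂.coe_toBasis]
        exact h8 j k
    intro Z hZ W hW x _
    have h10 : B Z W = 0 := congrArg (fun f => f ⟨Z, hZ⟩ ⟨W, hW⟩) h9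
    rw [← hB, h10, inner_zero_left]
  · rw [h4, add_eq_left]
    exact Finset.sum_eq_zero fun j _ => Finset.sum_eq_zero fun k _ =>
      h0 _ (b₂ j).2 _ (b₂ k).2 _ (Submodule.starProjection_apply_mem _ _)

end SemiSlantWarpedPoint
end PointwiseInequality

section Main

open Filter Topology

variable {EN : Type*} [NormedAddCommGroup EN] [NormedSpace ℝ EN] [FiniteDimensional ℝ EN]
  {HN : Type*} [TopologicalSpace HN] {I : ModelWithCorners ℝ EN HN}
  {N : Type*} [TopologicalSpace N] [ChartedSpace HN N] [IsManifold I ∞ N]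
  [RiemannianBundle (fun x : N => TangentSpace I x)]
  [IsContMDiffRiemannianBundle I ∞ EN (fun x : N => TangentSpace I x)]
  {EB : Type*} [NormedAddCommGroup EB] [NormedSpace ℝ EB] [FiniteDimensional ℝ EB]
  {HB : Type*} [TopologicalSpace HB] {IB : ModelWithCorners ℝ EB HB} [IB.Boundaryless]
  {B : Type*} [TopologicalSpace B] [ChartedSpace HB B] [IsManifold IB ∞ B]
  [RiemannianBundle (fun x : B => TangentSpace IB x)]
  [IsContMDiffRiemannianBundle IB ∞ EB (fun x : B => TangentSpace IB x)]
  {EF : Type*} [NormedAddCommGroup EF] [NormedSpace ℝ EF] [FiniteDimensional ℝ EF]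
  {HF : Type*} [TopologicalSpace HF] {IF : ModelWithCorners ℝ EF HF} [IF.Boundaryless]
  {F : Type*} [TopologicalSpace F] [ChartedSpace HF F] [IsManifold IF ∞ F]
  [RiemannianBundle (fun x : F => TangentSpace IF x)]
  [IsContMDiffRiemannianBundle IF ∞ EF (fun x : F => TangentSpace IF x)]
  [RiemannianBundle (fun p : B × F => TangentSpace (IB.prod IF) p)]
  {S : AlmostContactMetric I N} {f : B → ℝ} {i : B × F → N} {θ : B × F → ℝ}

theorem semiSlantPoint (hi : IsIsometricImmersion I (IB.prod IF) i)
    (hslant : S.IsPointwiseSemiSlant (IB.prod IF) i (baseDistribution IB IF)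
      (fiberDistribution IB IF) θ)
    (hproper : ∀ p, θ p ∈ Set.Ioo 0 (Real.pi / 2))
    (hξ : ∀ p, S.ξ (i p) ∈ tangentRange I (IB.prod IF) i p) (p : B × F) :
    SemiSlantPoint (S.φ (i p)).toLinearMap (S.ξ (i p)) (S.η (i p)).toLinearMap
      (mfderiv (IB.prod IF) I i p).toLinearMap (baseDistribution IB IF p)
      (fiberDistribution IB IF p) (θ p) where
  contact := S.isAlmostContact (i p)
  inner_L := hi.inner_mfderiv p
  orthogonal := hslant.orthogonal p
  invariant := hslant.invariant p
  slant := hslant.slant p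
  proper := hproper p
  ξ_mem := hξ p

theorem metricDeriv_zero_left {q : B} (u v : TangentSpace IB q) : metricDeriv IB 0 u v = 0 := by
  simp [metricDeriv]

theorem metricDeriv_zero_mid {q : B} (w v : TangentSpace IB q) : metricDeriv IB w 0 v = 0 := by
  simpa using metricDeriv_smul_mid w (0 : TangentSpace IB q) v (0 : ℝ)

theorem metricDeriv_zero_right {q : B} (w u : TangentSpace IB q) : metricDeriv IB w u 0 = 0 := by
  simpa using metricDeriv_smul_right w u (0 : TangentSpace IB q) (0 : ℝ)

theorem semiSlantWarpedPoint (hf : IsWarpedProduct IB IF (F := F) f)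
    (hi : IsIsometricImmersion I (IB.prod IF) i)
    (hslant : S.IsPointwiseSemiSlant (IB.prod IF) i (baseDistribution IB IF)
      (fiberDistribution IB IF) θ)
    (hproper : ∀ p, θ p ∈ Set.Ioo 0 (Real.pi / 2))
    (hξ : ∀ p, S.ξ (i p) ∈ tangentRange I (IB.prod IF) i p) (p : B × F) {κ μ : ℝ}
    (hS : S.TransSasakianAt κ μ (i p)) :
    SemiSlantWarpedPoint (S.φ (i p)).toLinearMap (S.ξ (i p)) (S.η (i p)).toLinearMap
      (mfderiv (IB.prod IF) I i p).toLinearMap (baseDistribution IB IF p)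
      (fiberDistribution IB IF p) (θ p) (ambientDeriv hi.contMDiff p)
      (mvfderiv (IB.prod IF) (fun q : B × F => Real.log (f q.1)) p).toLinearMap κ μ := by
  have hpt := semiSlantPoint hi hslant hproper hξ
  have hB : ∀ {X : TangentSpace (IB.prod IF) p}, X ∈ baseDistribution IB IF p →
      mfderiv (IB.prod IF) IF (Prod.snd : B × F → F) p X = 0 := fun h => h
  have hF : ∀ {X : TangentSpace (IB.prod IF) p}, X ∈ fiberDistribution IB IF p →
      mfderiv (IB.prod IF) IB (Prod.fst : B × F → B) p X = 0 := fun h => h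
  have hl : ∀ {Z : TangentSpace (IB.prod IF) p}, Z ∈ fiberDistribution IB IF p →
      mvfderiv (IB.prod IF) (fun q : B × F => Real.log (f q.1)) p Z = 0 := fun hZ => by
    rw [hf.mvfderiv_log, hF hZ, map_zero, zero_div]
  refine
    { toSemiSlantPoint := hpt p
      symm := ambientDeriv_symm hi.contMDiff p
      base_base_fiber := fun X hX Y hY Z hZ => ?_
      base_fiber_base := fun X hX Z hZ Y hY => ?_
      base_fiber_fiber := fun X hX Z hZ W hW => ?_
      fiber_fiber_base := fun Z hZ W hW X hX => ?_
      log_fiber := fun Z hZ => hl hZ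
      deriv_φ := fun u X hX Z hZ => ?_
      deriv_ξ := fun u W hW => ?_ }
  · refine (inner_ambientDeriv hi X Y Z).trans ?_
    simp only [hf.metricDeriv_eq, hB hX, hB hY, hF hZ, metricDeriv_zero_left, metricDeriv_zero_mid,
      metricDeriv_zero_right, inner_zero_left, inner_zero_right]
    ring
  · refine (inner_ambientDeriv hi X Z Y).trans ?_
    simp only [hf.metricDeriv_eq, hB hX, hB hY, hF hZ, metricDeriv_zero_left, metricDeriv_zero_mid,
      metricDeriv_zero_right, inner_zero_left, inner_zero_right]
    ring
  · refine (inner_ambientDeriv hi X Z W).trans ?_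
    change _ = mvfderiv (IB.prod IF) (fun q : B × F => Real.log (f q.1)) p X * _
    simp only [hf.metricDeriv_eq, hB hX, hF hZ, hF hW, hl hZ, hl hW, metricDeriv_zero_left,
      metricDeriv_zero_mid, metricDeriv_zero_right, inner_zero_right, hf.inner_eq]
    ring
  · refine (inner_ambientDeriv hi Z W X).trans ?_
    change _ = -(mvfderiv (IB.prod IF) (fun q : B × F => Real.log (f q.1)) p X * _)
    simp only [hf.metricDeriv_eq, hB hX, hF hZ, hF hW, hl hZ, hl hW, metricDeriv_zero_left,
      metricDeriv_zero_mid, metricDeriv_zero_right, inner_zero_right, hf.inner_eq]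
    ring
  · have h := inner_nablaφ_of_eventually hi.contMDiff S u X Z (by
      filter_upwards [chart_source_mem_nhds (ModelProd HB HF) p] with x hx
      exact (hpt x).inner_φ_base_fiber (coordField_mem_baseDistribution hx hX)
        (coordField_mem_fiberDistribution hx hZ))
    rw [hS.1] at h
    exact h
  · have h := inner_nablaξ_of_eventually hi.contMDiff S u W (by
      filter_upwards [chart_source_mem_nhds (ModelProd HB HF) p] with x hx
      exact (hpt x).inner_ξ_fiber (coordField_mem_fiberDistribution hx hW))
    rw [hS.2] at h
    exact h

/-- The inequality for warped product pointwise semi-slant submanifolds of trans-Sasakian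
manifolds of type `(κ, μ)`. -/
theorem le_sqNormSecondFF {n m₁ m₂ : ℕ} (hdimN : Module.finrank ℝ EN = 2 * n + 1)
    (hdimB : Module.finrank ℝ EB = 2 * m₁ + 1) (hdimF : Module.finrank ℝ EF = 2 * m₂)
    (hn : n = m₁ + 2 * m₂) (hf : IsWarpedProduct IB IF (F := F) f)
    (hi : IsIsometricImmersion I (IB.prod IF) i)
    (hslant : S.IsPointwiseSemiSlant (IB.prod IF) i (baseDistribution IB IF)
      (fiberDistribution IB IF) θ)
    (hproper : ∀ p, θ p ∈ Set.Ioo 0 (Real.pi / 2))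
    (hξ : ∀ p, S.ξ (i p) ∈ tangentRange I (IB.prod IF) i p) (p : B × F) {κ μ C : ℝ}
    (hS : S.TransSasakianAt κ μ (i p))
    (hC : C = 4 * m₂ * (1 / Real.sin (θ p) ^ 2 + Real.cot (θ p) ^ 2) *
      ‖S.φ (i p) (mfderiv (IB.prod IF) I i p
        (grad (IB.prod IF) (fun q : B × F => Real.log (f q.1)) p))‖ ^ 2
      + κ ^ 2 * (4 * m₂ * Real.sin (θ p) ^ 2)) :
    C ≤ sqNormSecondFF I (IB.prod IF) i p ∧
      (sqNormSecondFF I (IB.prod IF) i p = C ↔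
        ∀ Z ∈ fiberDistribution IB IF p, ∀ W ∈ fiberDistribution IB IF p,
          ∀ V ∈ normalSpace I (IB.prod IF) i p,
            ⟪secondFF I (IB.prod IF) i p Z W, V⟫_ℝ = 0) := by
  refine (semiSlantWarpedPoint hf hi hslant hproper hξ p hS).le_sum_inner_starProjection
    (stdOrthonormalBasis ℝ (TangentSpace (IB.prod IF) p)) ?_ (inner_grad _ p) ?_ rfl
  · rw [finrank_fiberDistribution]
    change Module.finrank ℝ EN = Module.finrank ℝ (EB × EF) + _
    rw [Module.finrank_prod]
    omega
  · rw [finrank_fiberDistribution, hdimF, hC]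
    push_cast
    change _ = 2 * (2 * (m₂ : ℝ)) * (_ * ‖S.φ (i p) (mfderiv (IB.prod IF) I i p
        (grad (IB.prod IF) (fun q : B × F => Real.log (f q.1)) p))‖ ^ 2 + _)
    ring

end Main
end SemiSlant

theorem theorem10p1
    {EN : Type*} [NormedAddCommGroup EN] [NormedSpace ℝ EN] [FiniteDimensional ℝ EN]
    {N : Type*} [TopologicalSpace N] [ChartedSpace EN N] [IsManifold 𝓘(ℝ, EN) ∞ N]
    [RiemannianBundle (fun x : N => TangentSpace 𝓘(ℝ, EN) x)]
    [IsContMDiffRiemannianBundle 𝓘(ℝ, EN) ∞ EN (fun x : N => TangentSpace 𝓘(ℝ, EN) x)]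
    {EB : Type*} [NormedAddCommGroup EB] [NormedSpace ℝ EB] [FiniteDimensional ℝ EB]
    {B : Type*} [TopologicalSpace B] [ChartedSpace EB B] [IsManifold 𝓘(ℝ, EB) ∞ B]
    [RiemannianBundle (fun x : B => TangentSpace 𝓘(ℝ, EB) x)]
    [IsContMDiffRiemannianBundle 𝓘(ℝ, EB) ∞ EB (fun x : B => TangentSpace 𝓘(ℝ, EB) x)]
    {EF : Type*} [NormedAddCommGroup EF] [NormedSpace ℝ EF] [FiniteDimensional ℝ EF]
    {F : Type*} [TopologicalSpace F] [ChartedSpace EF F] [IsManifold 𝓘(ℝ, EF) ∞ F]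
    [RiemannianBundle (fun x : F => TangentSpace 𝓘(ℝ, EF) x)]
    [IsContMDiffRiemannianBundle 𝓘(ℝ, EF) ∞ EF (fun x : F => TangentSpace 𝓘(ℝ, EF) x)]
    [RiemannianBundle (fun p : B × F => TangentSpace (𝓘(ℝ, EB).prod 𝓘(ℝ, EF)) p)]
    [IsContMDiffRiemannianBundle (𝓘(ℝ, EB).prod 𝓘(ℝ, EF)) ∞ (EB × EF)
      (fun p : B × F => TangentSpace (𝓘(ℝ, EB).prod 𝓘(ℝ, EF)) p)]
    (n m₁ m₂ : ℕ)
    (hdimN : Module.finrank ℝ EN = 2 * n + 1)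
    (hdimB : Module.finrank ℝ EB = 2 * m₁ + 1)
    (hdimF : Module.finrank ℝ EF = 2 * m₂)
    (hn : n = m₁ + 2 * m₂)
    (S : SemiSlant.AlmostContactMetric 𝓘(ℝ, EN) N)
    (f : B → ℝ) (hf : SemiSlant.IsWarpedProduct 𝓘(ℝ, EB) 𝓘(ℝ, EF) (F := F) f)
    (i : B × F → N)
    (hi : SemiSlant.IsIsometricImmersion 𝓘(ℝ, EN) (𝓘(ℝ, EB).prod 𝓘(ℝ, EF)) i)
    (θ : B × F → ℝ)
    (hslant : S.IsPointwiseSemiSlant (𝓘(ℝ, EB).prod 𝓘(ℝ, EF)) i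
      (SemiSlant.baseDistribution 𝓘(ℝ, EB) 𝓘(ℝ, EF))
      (SemiSlant.fiberDistribution 𝓘(ℝ, EB) 𝓘(ℝ, EF)) θ)
    (hproper : ∀ p, θ p ∈ Set.Ioo 0 (Real.pi / 2))
    (hξ : ∀ p, S.ξ (i p) ∈ SemiSlant.tangentRange 𝓘(ℝ, EN) (𝓘(ℝ, EB).prod 𝓘(ℝ, EF)) i p) :
    let I := 𝓘(ℝ, EN)
    let J := 𝓘(ℝ, EB).prod 𝓘(ℝ, EF)
    -- the function `‖φ ∇(ln f)‖²` on `M = B ×_f F`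
    let G : B × F → ℝ := fun p =>
      ‖S.φ (i p) (mfderiv J I i p
        (SemiSlant.grad J (fun q : B × F => Real.log (f q.1)) p))‖ ^ 2
    -- the lower bound common to the three classes of ambient manifolds
    let K : B × F → ℝ := fun p =>
      4 * m₂ * (1 / Real.sin (θ p) ^ 2 + Real.cot (θ p) ^ 2) * G p
    -- `g(h(Z, W), V) = 0` for all `Z`, `W` in `TF` and all normal vectors `V` at the point `p`
    let Orth : B × F → Prop := fun p =>
      ∀ Z ∈ SemiSlant.fiberDistribution 𝓘(ℝ, EB) 𝓘(ℝ, EF) p,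
        ∀ W ∈ SemiSlant.fiberDistribution 𝓘(ℝ, EB) 𝓘(ℝ, EF) p,
          ∀ V ∈ SemiSlant.normalSpace I J i p, ⟪SemiSlant.secondFF I J i p Z W, V⟫_ℝ = 0
    (S.IsSasakian → ∀ p,
      K p + 4 * m₂ * Real.sin (θ p) ^ 2 ≤ SemiSlant.sqNormSecondFF I J i p ∧
      (SemiSlant.sqNormSecondFF I J i p = K p + 4 * m₂ * Real.sin (θ p) ^ 2 ↔ Orth p)) ∧
    (S.IsCosymplectic → ∀ p,
      K p ≤ SemiSlant.sqNormSecondFF I J i p ∧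
      (SemiSlant.sqNormSecondFF I J i p = K p ↔ Orth p)) ∧
    (S.IsKenmotsu → ∀ p,
      K p ≤ SemiSlant.sqNormSecondFF I J i p ∧
      (SemiSlant.sqNormSecondFF I J i p = K p ↔ Orth p))
  := by
  intro I J G K Orth
  have key := fun (p : B × F) (κ μ C : ℝ) =>
    SemiSlant.le_sqNormSecondFF (κ := κ) (μ := μ) (C := C) hdimN hdimB hdimF hn hf hi hslant
      hproper hξ p
  refine ⟨fun hS p => key p 1 0 _ (hS.transSasakianAt (i p)) ?_,
    fun hS p => key p 0 0 _ (hS.transSasakianAt (i p)) ?_,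
    fun hS p => key p 0 1 _ (hS.transSasakianAt (i p)) ?_⟩
  · rw [one_pow, one_mul]
  · rw [zero_pow two_ne_zero, zero_mul, add_zero]
  · rw [zero_pow two_ne_zero, zero_mul, add_zero]
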